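/- Let $K\subset\mathbb R^2$ be a curvilinear polygon: an open, bounded, simply connected set whose Lipschitz boundary $\partial K$ is a finite union of smooth (it suffices: regular $C^1$, up to the end points) arcs with disjoint interiors. Let $\mathbf n$ be the outward unit normal and $\mathbf t$ the counter-clockwise unit tangent on $\partial K$. Let $\phi\in H^1(K)$ be harmonic in $K$. Consider the following construction. 1. Let $\hat\phi\in H^1(K)$ be a solution of the Neumann problem $\Delta\hat\phi=0$ in $K$, $\partial\hat\phi/\partial\mathbf n=-\partial\phi/\partial\mathbf t$ on $\partial K$. 2. Let $\rho\in H^1(K)$ be a solution of the Neumann problem $\Delta\rho=0$ in $K$, $\partial\rho/\partial\mathbf n=(\phi,-\hat\phi)\cdot\mathbf n$ on $\partial K$. 3. Let $\hat\rho\in H^1(K)$ be a solution of the Neumann problem $\Delta\hat\rho=0$ in $K$, $\partial\hat\rho/\partial\mathbf n=(\hat\phi,\phi)\cdot\mathbf n$ on $\partial K$. 4. Set $\Phi=(x_1\rho+x_2\hat\rho)/4$. The Neumann conditions are understood in the usual weak sense: $u\in H^1(K)$ satisfies $\partial u/\partial\mathbf n=\ell$ on $\partial K$ if $\int_K\nabla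 u\cdot\nabla v\,dx=\langle\ell,v\rangle$ for all $v\in C^\infty(\mathbb R^2)$. The functions $\phi,\hat\phi$ on $\partial K$ are traces in $L^2(\partial K)$ of $H^1(K)$ functions, and the tangential derivative of a trace $g$ is the distribution $\langle\partial g/\partial\mathbf t,v\rangle=-\int_{\partial K}g\,\frac{\partial v}{\partial\mathbf t}\,ds$. Then the construction can always be carried out (the Neumann problem in step 1 has a solution, and for each solution $\hat\phi$ of it those in steps 2 and 3 have solutions), and for every choice of the solutions $\hat\phi,\rho,\hat\rho$: - $\Phi$ is $C^2$ in $K$ and $\Delta\Phi=\phi$ in $K$; - $\phi$ and $\hat\phi$ are harmonic conjugates in $K$, that is, both are harmonic and $\frac{\partial\phi}{\partial x_1}=\frac{\partial\hat\phi}{\partial x_2}$, $\frac{\partial\phi}{\partial x_2}=-\frac{\partial\hat\phi}{\partial x_1}$; - $\rho$ and $\hat\rho$ are harmonic conjugates in $K$ in the same sense; - moreover $\widehat\Phi=(x_1\hat\rho-x_2\rho)/4$ is $C^2$ in $K$ and satisfies $\Delta\widehat\Phi=\hat\phi$ in $K$. -/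

import Mathlib

open Set Filter Topology MeasureTheory
open scoped ContDiff NNReal

/-! The plane `ℝ²` is represented by `ℂ`, with coordinates `x₁ = z.re` and `x₂ = z.im`. -/

/-- `∂u/∂x₁` at `z`. -/
noncomputable def pdOne (u : ℂ → ℝ) (z : ℂ) : ℝ := fderiv ℝ u z 1

/-- `∂u/∂x₂` at `z`. -/
noncomputable def pdTwo (u : ℂ → ℝ) (z : ℂ) : ℝ := fderiv ℝ u z Complex.I

/-- `K` has a Lipschitz boundary: near each boundary point, in suitable rigidly moved
coordinates, `K` is the part of a rectangle above the graph of a Lipschitz function. -/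
def HasLipschitzBoundary (K : Set ℂ) : Prop :=
  ∀ p ∈ frontier K, ∃ (c : ℂ) (f : ℝ → ℝ) (M : ℝ≥0) (r h : ℝ),
    ‖c‖ = 1 ∧ LipschitzWith M f ∧ 0 < r ∧ 0 < h ∧
    ∀ x y : ℝ, |x| < r → |y| < h → (p + c * ⟨x, y⟩ ∈ K ↔ f x < y)

/-- A curvilinear polygon: a bounded simply connected open set `K` of the plane whose Lipschitz
boundary is a finite union of smooth arcs (the edges) with disjoint interiors. The edges come with
an arc length parametrization, in the counter-clockwise direction. -/
structure CurvilinearPolygon where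
  /-- The open set `K`. -/
  carrier : Set ℂ
  isOpen : IsOpen carrier
  isBounded : Bornology.IsBounded carrier
  isSimplyConnected : IsSimplyConnected carrier
  hasLipschitzBoundary : HasLipschitzBoundary carrier
  /-- The number of edges. -/
  numEdges : ℕ
  /-- The lengths of the edges. -/
  len : Fin numEdges → ℝ
  len_pos : ∀ i, 0 < len i
  /-- The `i`-th edge, parametrized by arc length on `[0, len i]`. -/
  edge : Fin numEdges → ℝ → ℂ
  contDiff_edge : ∀ i, ContDiff ℝ 1 (edge i)
  unit_speed : ∀ i, ∀ s ∈ Icc 0 (len i), ‖deriv (edge i) s‖ = 1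
  injOn_edge : ∀ i, InjOn (edge i) (Icc 0 (len i))
  frontier_eq : frontier carrier = ⋃ i, edge i '' Icc 0 (len i)
  /-- Two different edges have at most end points in common. -/
  disjoint_edges : ∀ i j, i ≠ j →
    Disjoint (edge i '' Ioo 0 (len i)) (edge j '' Icc 0 (len j))
  /-- Counter-clockwise orientation: at interior points of an edge the set `K` lies to the left
  of the unit tangent `t`, that is, `-i t` is the outward unit normal. -/
  orientation : ∀ i, ∀ s ∈ Ioo 0 (len i), ∀ᶠ ε : ℝ in 𝓝[>] 0,
    edge i s + ε * (Complex.I * deriv (edge i) s) ∈ carrier ∧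
    edge i s - ε * (Complex.I * deriv (edge i) s) ∉ closure carrier

namespace CurvilinearPolygon

variable (P : CurvilinearPolygon)

/-- The counter-clockwise unit tangent `t` at the point with parameter `s` of the `i`-th edge. -/
noncomputable def tangent (i : Fin P.numEdges) (s : ℝ) : ℂ := deriv (P.edge i) s

/-- The outward unit normal `n`: the tangent turned clockwise by a right angle. -/
noncomputable def normal (i : Fin P.numEdges) (s : ℝ) : ℂ := -Complex.I * P.tangent i s

/-- The boundary integral `∫_{∂K} F ds` of a function `F` given, edge by edge, in terms of the
arc length parameter. -/
noncomputable def boundaryIntegral (F : Fin P.numEdges → ℝ → ℝ) : ℝ :=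
  ∑ i, ∫ s in Icc 0 (P.len i), F i s

/-- `u` is a harmonic function in `K` that belongs to `H¹(K)`. (A harmonic function is smooth, so
its weak derivatives are the classical ones.) -/
def IsHarmonicH1 (u : ℂ → ℝ) : Prop :=
  InnerProductSpace.HarmonicOnNhd u P.carrier ∧
  MemLp u 2 (volume.restrict P.carrier) ∧
  MemLp (pdOne u) 2 (volume.restrict P.carrier) ∧
  MemLp (pdTwo u) 2 (volume.restrict P.carrier)

/-- `g` is the trace on `∂K` of the function `u` (differentiable in `K`): there are functions
`w k`, smooth up to the boundary, that converge to `u` in `H¹(K)` and whose boundary values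
converge to `g` in `L²(∂K)`. -/
def HasTrace (u g : ℂ → ℝ) : Prop :=
  (∀ i, MemLp (fun s => g (P.edge i s)) 2 (volume.restrict (Icc 0 (P.len i)))) ∧
  ∃ w : ℕ → ℂ → ℝ, (∀ k, ContDiff ℝ ∞ (w k)) ∧
    Tendsto (fun k => eLpNorm (fun z => w k z - u z) 2 (volume.restrict P.carrier))
      atTop (𝓝 0) ∧
    Tendsto (fun k => eLpNorm (fun z => pdOne (w k) z - pdOne u z) 2
      (volume.restrict P.carrier)) atTop (𝓝 0) ∧
    Tendsto (fun k => eLpNorm (fun z => pdTwo (w k) z - pdTwo u z) 2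
      (volume.restrict P.carrier)) atTop (𝓝 0) ∧
    ∀ i, Tendsto (fun k => eLpNorm (fun s => w k (P.edge i s) - g (P.edge i s)) 2
      (volume.restrict (Icc 0 (P.len i)))) atTop (𝓝 0)

/-- The tangential derivative `∂g/∂t` of `g ∈ L²(∂K)`, a distribution on the closed curve `∂K`:
`⟨∂g/∂t, v⟩ = -∫_{∂K} g ∂v/∂t ds`. -/
noncomputable def tangentialDeriv (g : ℂ → ℝ) (v : ℂ → ℝ) : ℝ :=
  -P.boundaryIntegral fun i s => g (P.edge i s) * fderiv ℝ v (P.edge i s) (P.tangent i s)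

/-- The distribution on `∂K` given by the normal component `(a, b) · n` of a vector field
with components `a, b ∈ L²(∂K)`: `⟨(a, b) · n, v⟩ = ∫_{∂K} ((a, b) · n) v ds`. -/
noncomputable def normalComponent (a b : ℂ → ℝ) (v : ℂ → ℝ) : ℝ :=
  P.boundaryIntegral fun i s =>
    (a (P.edge i s) * (P.normal i s).re + b (P.edge i s) * (P.normal i s).im) * v (P.edge i s)

/-- `u ∈ H¹(K)` solves the Neumann problem `Δu = 0` in `K`, `∂u/∂n = ℓ` on `∂K`, for a distribution
`ℓ` on `∂K`. The boundary condition has its usual weak meaning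
`∫_K ∇u · ∇v dx = ⟨ℓ, v⟩` for all `v` that are smooth up to the boundary. -/
def IsNeumannSolution (ℓ : (ℂ → ℝ) → ℝ) (u : ℂ → ℝ) : Prop :=
  P.IsHarmonicH1 u ∧
  ∀ v : ℂ → ℝ, ContDiff ℝ ∞ v →
    ∫ z in P.carrier, (pdOne u z * pdOne v z + pdTwo u z * pdTwo v z) = ℓ v

/-- `u` solves `Δu = 0` in `K`, `∂u/∂n = -∂φ/∂t` on `∂K`. -/
def SolvesTangentialNeumann (φ u : ℂ → ℝ) : Prop :=
  ∃ g, P.HasTrace φ g ∧ P.IsNeumannSolution (fun v => -P.tangentialDeriv g v) u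

/-- `u` solves `Δu = 0` in `K`, `∂u/∂n = (a, b) · n` on `∂K`, for functions `a, b` in `K`
that have traces on `∂K`. -/
def SolvesNormalNeumann (a b u : ℂ → ℝ) : Prop :=
  ∃ ga gb, P.HasTrace a ga ∧ P.HasTrace b gb ∧ P.IsNeumannSolution (P.normalComponent ga gb) u

/-- `u` and `v` are harmonic conjugates in `K`: both are harmonic, and they satisfy the
Cauchy–Riemann equations `∂u/∂x₁ = ∂v/∂x₂`, `∂u/∂x₂ = -∂v/∂x₁`. -/
def IsHarmonicConjugate (u v : ℂ → ℝ) : Prop :=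
  InnerProductSpace.HarmonicOnNhd u P.carrier ∧ InnerProductSpace.HarmonicOnNhd v P.carrier ∧
  ∀ z ∈ P.carrier, pdOne u z = pdTwo v z ∧ pdTwo u z = -pdOne v z

end CurvilinearPolygon

/-- `ΔU = f` in `K`, in the classical sense. -/
def HasLaplacianOn (U f : ℂ → ℝ) (K : Set ℂ) : Prop :=
  ContDiffOn ℝ 2 U K ∧ ∀ z ∈ K, Laplacian.laplacian U z = f z

/-! Put `F = φ + iφ̂` and `R = ρ + iρ̂`. If `F` is holomorphic and `R' = F`, then `Φ + iΦ̂ = z̄R/4`.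
Since `Δ = 4∂∂̄`, this gives `Δ(z̄R/4) = R' = φ + iφ̂`, which is both Laplace equations at once. It
remains to show that the three Neumann problems force these relations, that is, that they determine
the gradients of `φ̂`, `ρ` and `ρ̂`.

Existence. As `K` is simply connected, `∂₁φ - i∂₂φ` has a primitive, whose imaginary part is a
conjugate of `φ` (`exists_primitive_gradient`). Then `φ + iφ̂` is holomorphic and has a primitive
too, with real and imaginary parts of gradient `(φ, -φ̂)` and `(φ̂, φ)`. Integration by parts shows
that these functions solve the weak Neumann problems (`HasTrace.integral_rotated_gradient`,
`integral_field_eq_normalComponent`).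

Uniqueness. The gradient of the difference of two solutions is orthogonal to the gradients of all
smooth functions. Functions smooth up to the boundary approximate the difference in `H¹(K)`, so that
gradient vanishes (`IsNeumannSolution.gradient_eq`). Hence every solution has the gradient of the
explicit one.

The analytic work lies in three facts about `K`: the divergence theorem (`setIntegral_fderiv`),
square integrability of functions with square integrable gradient (`memLp_of_memLp_gradient`), and
existence of traces together with smooth approximations (`exists_hasTrace`). All three are localized
by a partition of unity to charts that flatten the Lipschitz boundary by a shear. There the
fundamental theorem of calculus on vertical segments and translation in the inward direction
suffice. Boundary integrals pass between arc length and the chart coordinate because each edge is a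
piece of the graph, traversed with increasing abscissa. -/

/-! ### Primitives on simply connected open sets -/

/-- The complex plane with the discrete topology, the fibre of the covering whose sections are the
primitives of a holomorphic function. -/
@[ext]
structure DiscretePlane where
  /-- The underlying complex number. -/
  val : ℂ

instance : TopologicalSpace DiscretePlane := ⊥
instance : DiscreteTopology DiscretePlane := ⟨rfl⟩

/-- The covering of `K` glued from the local primitives `F i` on the sets `U i`: a point over `z` is
the value at `z` of a primitive. -/
def primitiveCore {K : Set ℂ} (U : K → Set ℂ) (hU : ∀ i, IsOpen (U i)) (hmem : ∀ i : K, (i : ℂ) ∈ U i)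
    (F : K → ℂ → ℂ)
    (hF : ∀ i j, ∀ z ∈ U i ∩ U j, ∀ᶠ w in 𝓝 z, F j w - F i w = F j z - F i z) :
    FiberBundleCore K K DiscretePlane where
  baseSet i := Subtype.val ⁻¹' U i
  isOpen_baseSet i := (hU i).preimage continuous_subtype_val
  indexAt x := x
  mem_baseSet_at x := hmem x
  -- The coordinate `v` over `U i` stands for the value `v + F i z`, which must not depend on `i`.
  coordChange i j z v := ⟨v.val - (F j z - F i z)⟩
  coordChange_self i x hx v := by
    rw [sub_self, sub_zero]
  continuousOn_coordChange i j := by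
    rintro ⟨z, v⟩ ⟨hz, -⟩
    refine ContinuousAt.continuousWithinAt ?_
    have h1 : ∀ᶠ q : K × DiscretePlane in 𝓝 (z, v),
        F j q.1 - F i q.1 = F j z - F i z :=
      ((continuous_subtype_val.comp continuous_fst).tendsto (z, v)).eventually (hF i j z hz)
    have h2 : ∀ᶠ q : K × DiscretePlane in 𝓝 (z, v), q.2 = v :=
      (continuous_snd.tendsto (z, v)).eventually
        (show ∀ᶠ w in 𝓝 v, w = v by rw [nhds_discrete]; simp)
    refine ContinuousAt.congr (f := fun _ => (⟨v.val - (F j z - F i z)⟩ : DiscretePlane))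
      continuousAt_const ?_
    filter_upwards [h1, h2] with q hq1 hq2
    rw [hq1, hq2]
  coordChange_comp i j k x hx v := by
    ext
    simp only
    ring

/-- A holomorphic function on a simply connected open set has a primitive. -/
theorem isExactOn_of_isSimplyConnected {K : Set ℂ} (hK : IsOpen K) (hs : IsSimplyConnected K)
    {f : ℂ → ℂ} (hf : DifferentiableOn ℂ f K) : Complex.IsExactOn f K := by
  classical
  have hloc : ∀ i : K, ∃ r > 0, Metric.ball (i : ℂ) r ⊆ K := fun i =>
    Metric.isOpen_iff.1 hK i i.2
  choose r hr hrK using hloc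
  have hprim : ∀ i : K, Complex.IsExactOn f (Metric.ball (i : ℂ) (r i)) := fun i =>
    (hf.mono (hrK i)).isExactOn_ball
  choose F hF using hprim
  have hconst : ∀ i j : K, ∀ z ∈ Metric.ball (i : ℂ) (r i) ∩ Metric.ball (j : ℂ) (r j),
      ∀ᶠ w in 𝓝 z, F j w - F i w = F j z - F i z := by
    intro i j z hz
    have ho : IsOpen (Metric.ball (i : ℂ) (r i) ∩ Metric.ball (j : ℂ) (r j)) :=
      Metric.isOpen_ball.inter Metric.isOpen_ball
    have hc : Convex ℝ (Metric.ball (i : ℂ) (r i) ∩ Metric.ball (j : ℂ) (r j)) :=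
      (convex_ball _ _).inter (convex_ball _ _)
    filter_upwards [ho.mem_nhds hz] with w hw
    refine ho.is_const_of_deriv_eq_zero (f := fun w => F j w - F i w) hc.isPreconnected
      (fun x hx => ((hF j x hx.2).sub (hF i x hx.1)).differentiableAt.differentiableWithinAt)
      (fun x hx => ?_) hw hz
    simpa using ((hF j x hx.2).fun_sub (hF i x hx.1)).deriv
  let Z := primitiveCore (fun i : K => Metric.ball (i : ℂ) (r i)) (fun i => Metric.isOpen_ball)
    (fun i => Metric.mem_ball_self (hr i)) F hconst
  have hcov : IsCoveringMap (Bundle.TotalSpace.proj : Bundle.TotalSpace DiscretePlane Z.Fiber → K) :=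
    FiberBundle.isCoveringMap
  have := hs.simplyConnectedSpace
  have := hK.locallyPathConnectedSpace
  obtain ⟨x₀, hx₀⟩ := hs.nonempty
  -- Simple connectedness enters here: the identity of `K` lifts to a global section of the
  -- covering.
  obtain ⟨S, ⟨-, hS⟩, -⟩ := hcov.existsUnique_continuousMap_lifts (ContinuousMap.id K) ⟨x₀, hx₀⟩
    ⟨⟨x₀, hx₀⟩, (⟨0⟩ : DiscretePlane)⟩ rfl
  have hSproj : ∀ x : K, (S x).proj = x := fun x => congr_fun hS x
  let val : ∀ x : K, Z.Fiber x → ℂ := fun x v => DiscretePlane.val v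
  let G : ℂ → ℂ := fun z => if hz : z ∈ K then val _ (S ⟨z, hz⟩).snd + F ⟨z, hz⟩ z else 0
  refine ⟨G, fun z hz => ?_⟩
  let i : K := ⟨z, hz⟩
  have hsrc : (S i) ∈ (Z.localTriv i).source := by
    rw [(Z.localTriv i).mem_source]
    change (S i).proj ∈ _
    rw [hSproj]
    exact Metric.mem_ball_self (hr i)
  have hc : ContinuousAt (fun x => ((Z.localTriv i) (S x)).2) i :=
    (continuous_snd.continuousAt.comp ((Z.localTriv i).toOpenPartialHomeomorph.continuousAt hsrc)).comp
      S.continuous.continuousAt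
  -- The fibre is discrete, so the section has a locally constant coordinate: near `z`, `G` differs
  -- from `F i` by a constant.
  have hev : ∀ᶠ x in 𝓝 i, ((Z.localTriv i) (S x)).2 = ((Z.localTriv i) (S i)).2 :=
    hc.eventually (show ∀ᶠ w in 𝓝 _, w = _ by rw [nhds_discrete]; simp)
  have hval : ∀ x : K, (((Z.localTriv i) (S x)).2).val = G x - F i x := by
    intro x
    rw [Z.localTriv_apply]
    have : G x = val _ (S x).snd + F x x := by simp [G]
    rw [this]
    change DiscretePlane.val (S x).snd - (F i ((S x).proj : K) - F ((S x).proj : K) ((S x).proj : K)) = _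
    rw [hSproj]
    ring
  have hG : G =ᶠ[𝓝 z] fun w => (G z - F i z) + F i w := by
    have h1 : ∀ᶠ w in 𝓝 z, ∀ hw : w ∈ K, ((Z.localTriv i) (S ⟨w, hw⟩)).2 = ((Z.localTriv i) (S i)).2 := by
      rw [nhds_subtype_eq_comap, eventually_comap] at hev
      filter_upwards [hev] with w hw hwK
      exact hw ⟨w, hwK⟩ rfl
    filter_upwards [h1, hK.mem_nhds hz] with w hw hwK
    have h2 := congrArg DiscretePlane.val (hw hwK)
    rw [hval, hval] at h2
    change G w - F i w = G z - F i z at h2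
    rw [← h2]
    ring
  exact ((hF i z (Metric.mem_ball_self (hr i))).const_add _).congr_of_eventuallyEq hG

/-! ### Charts flattening a Lipschitz boundary -/

/-- The shear `(x, t) ↦ (x, f x + t)`, as a homeomorphism. -/
def shearHomeomorph (f : ℝ → ℝ) (hf : Continuous f) : ℝ × ℝ ≃ₜ ℝ × ℝ where
  toFun q := (q.1, f q.1 + q.2)
  invFun q := (q.1, q.2 - f q.1)
  left_inv q := by simp
  right_inv q := by simp
  continuous_toFun := by fun_prop
  continuous_invFun := by fun_prop

/-- Each vertical line is merely translated. -/
theorem measurePreserving_shearHomeomorph (f : ℝ → ℝ) (hf : Continuous f) :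
    MeasurePreserving (shearHomeomorph f hf) := by
  refine (MeasurePreserving.id volume).skew_product (g := fun x t => f x + t) ?_ ?_
  · exact (by fun_prop : Continuous fun q : ℝ × ℝ => f q.1 + q.2).measurable
  · exact Eventually.of_forall fun x => (measurePreserving_add_left volume (f x)).map_eq

/-- A chart that flattens the boundary of `K`: the map `(x, t) ↦ p + c (x + i (f x + t))` with a
Lipschitz function `f` takes the part `0 < t` of the rectangle `|x| < r`, `|t| < δ` into `K` and
the rest of it out of `K`. -/
structure FlatChart (K : Set ℂ) where
  p : ℂ
  c : ℂ
  f : ℝ → ℝ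
  M : ℝ≥0
  r : ℝ
  δ : ℝ
  norm_c : ‖c‖ = 1
  lip : LipschitzWith M f
  r_pos : 0 < r
  δ_pos : 0 < δ
  mem_iff' : ∀ x t : ℝ, |x| < r → |t| < δ → (p + c * ⟨x, f x + t⟩ ∈ K ↔ 0 < t)

namespace FlatChart

variable {K : Set ℂ} (C : FlatChart K)

theorem c_ne_zero : C.c ≠ 0 := by
  intro h
  have := C.norm_c
  simp [h] at this

/-- The chart as a homeomorphism of `ℝ × ℝ` onto the plane. -/
noncomputable def map : ℝ × ℝ ≃ₜ ℂ :=
  (shearHomeomorph C.f C.lip.continuous).trans <|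
    Complex.equivRealProdCLM.symm.toHomeomorph.trans <|
      (Homeomorph.mulLeft₀ C.c C.c_ne_zero).trans (Homeomorph.addLeft C.p)

theorem map_apply (q : ℝ × ℝ) : C.map q = C.p + C.c * ⟨q.1, C.f q.1 + q.2⟩ := rfl

theorem map_apply' (x t : ℝ) :
    C.map (x, t) = C.p + x * C.c + (C.f x + t) * (C.c * Complex.I) := by
  rw [map_apply, Complex.mk_eq_add_mul_I]
  push_cast
  ring

theorem map_add (x t ε : ℝ) : C.map (x, t + ε) = C.map (x, t) + ε * (C.c * Complex.I) := by
  rw [map_apply', map_apply']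
  push_cast
  ring

theorem measurePreserving_map : MeasurePreserving C.map := by
  refine ((measurePreserving_add_left volume C.p).comp ?_).comp
    (Complex.volume_preserving_equiv_real_prod.symm.comp
      (measurePreserving_shearHomeomorph C.f C.lip.continuous))
  exact (rotation ⟨C.c, mem_sphere_zero_iff_norm.2 C.norm_c⟩).measurePreserving

/-- The rectangle `|x| < r`, `|t| < δ`. -/
def rect : Set (ℝ × ℝ) := Ioo (-C.r) C.r ×ˢ Ioo (-C.δ) C.δ

/-- The domain of the chart in the plane. -/
def box : Set ℂ := C.map '' C.rect

theorem isOpen_rect : IsOpen C.rect := isOpen_Ioo.prod isOpen_Ioo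

theorem isOpen_box : IsOpen C.box := C.map.isOpenMap _ C.isOpen_rect

theorem mem_box_iff {x t : ℝ} : C.map (x, t) ∈ C.box ↔ |x| < C.r ∧ |t| < C.δ := by
  rw [box, C.map.injective.mem_set_image, rect, mem_prod, mem_Ioo, mem_Ioo, abs_lt, abs_lt]

theorem mem_iff {x t : ℝ} (hx : |x| < C.r) (ht : |t| < C.δ) : C.map (x, t) ∈ K ↔ 0 < t :=
  C.mem_iff' x t hx ht

theorem exists_map_eq (z : ℂ) : ∃ x t, C.map (x, t) = z := by
  obtain ⟨⟨x, t⟩, h⟩ := C.map.surjective z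
  exact ⟨x, t, h⟩

/-- Points with `t < 0` have the open lower half of the rectangle as a neighbourhood that misses
`K`; points with `t = 0` are limits of points with `t > 0`. -/
theorem mem_frontier_iff (hK : IsOpen K) {x t : ℝ} (hx : |x| < C.r) (ht : |t| < C.δ) :
    C.map (x, t) ∈ frontier K ↔ t = 0 := by
  have hct : Continuous fun s => C.map (x, s) := C.map.continuous.comp (by fun_prop)
  rw [hK.frontier_eq, Set.mem_sdiff, C.mem_iff hx ht]
  constructor
  · rintro ⟨h1, h2⟩
    by_contra h0
    have hneg : t < 0 := lt_of_le_of_ne (not_lt.1 h2) h0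
    have hopen : IsOpen (C.map '' (Ioo (-C.r) C.r ×ˢ Ioo (-C.δ) 0)) :=
      C.map.isOpenMap _ (isOpen_Ioo.prod isOpen_Ioo)
    obtain ⟨z, ⟨⟨y, s⟩, ⟨hy, hs⟩, rfl⟩, hz⟩ := mem_closure_iff.1 h1 _ hopen
      ⟨(x, t), ⟨abs_lt.1 hx, (abs_lt.1 ht).1, hneg⟩, rfl⟩
    have := (C.mem_iff (abs_lt.2 hy) (abs_lt.2 ⟨hs.1, hs.2.trans C.δ_pos⟩)).1 hz
    exact absurd this (not_lt.2 hs.2.le)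
  · rintro rfl
    refine ⟨?_, lt_irrefl _⟩
    have h1 : Tendsto (fun s => C.map (x, s)) (𝓝[>] 0) (𝓝 (C.map (x, 0))) :=
      (hct.tendsto 0).mono_left nhdsWithin_le_nhds
    refine mem_closure_of_tendsto h1 ?_
    filter_upwards [Ioo_mem_nhdsGT C.δ_pos] with s hs
    exact (C.mem_iff hx (abs_lt.2 ⟨by linarith [hs.1, C.δ_pos], hs.2⟩)).2 hs.1

theorem mem_closure (hK : IsOpen K) {x t : ℝ} (hx : |x| < C.r) (ht : |t| < C.δ) :
    C.map (x, t) ∈ closure K ↔ 0 ≤ t := by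
  have h : C.map (x, t) ∈ closure K ↔ C.map (x, t) ∈ K ∨ C.map (x, t) ∈ frontier K := by
    rw [hK.frontier_eq, Set.mem_sdiff]
    constructor
    · intro h
      by_cases h' : C.map (x, t) ∈ K
      · exact Or.inl h'
      · exact Or.inr ⟨h, h'⟩
    · rintro (h | h)
      · exact subset_closure h
      · exact h.1
  rw [h, C.mem_iff hx ht, C.mem_frontier_iff hK hx ht, le_iff_lt_or_eq, eq_comm]

end FlatChart

/-- Every boundary point of an open set with Lipschitz boundary is in the domain of a flattening
chart. -/
theorem HasLipschitzBoundary.exists_flatChart {K : Set ℂ} (hK : IsOpen K)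
    (hL : HasLipschitzBoundary K) {p : ℂ} (hp : p ∈ frontier K) :
    ∃ C : FlatChart K, p ∈ C.box := by
  obtain ⟨c, f, M, r, h, hc, hf, hr, hh, hmem⟩ := hL p hp
  -- The graph must pass through `p`: `f 0 < 0` would put `p` into `K`, and `f 0 > 0` would keep a
  -- neighbourhood of `p` away from `K`.
  have hf0 : f 0 = 0 := by
    rw [hK.frontier_eq] at hp
    have h1 := hmem 0 0 (by simpa) (by simpa)
    have h2 : (p + c * (⟨0, 0⟩ : ℂ)) = p := by
      rw [show (⟨0, 0⟩ : ℂ) = 0 from rfl]; simp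
    rw [h2] at h1
    have h3 : 0 ≤ f 0 := by
      by_contra h
      exact hp.2 (h1.2 (not_le.1 h))
    by_contra hne
    have h4 : 0 < f 0 := lt_of_le_of_ne h3 (Ne.symm hne)
    let T : ℂ → ℂ := fun z => (z - p) / c
    have hc0 : c ≠ 0 := by rintro rfl; simp at hc
    have hT : Continuous T := by fun_prop
    have hTp : T p = 0 := by simp [T]
    have hev : ∀ᶠ z in 𝓝 p, |(T z).re| < r ∧ |(T z).im| < h ∧ (T z).im < f (T z).re := by
      have c1 : ContinuousAt (fun z => |(T z).re|) p := by fun_prop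
      have c2 : ContinuousAt (fun z => |(T z).im|) p := by fun_prop
      have c3 : ContinuousAt (fun z => (T z).im) p := by fun_prop
      have c4 : ContinuousAt (fun z => f (T z).re) p :=
        (hf.continuous.comp (Complex.continuous_re.comp hT)).continuousAt
      refine (c1.eventually_lt continuousAt_const (by simpa [hTp])).and
        ((c2.eventually_lt continuousAt_const (by simpa [hTp])).and
          (c3.eventually_lt c4 (by simpa [hTp])))
    obtain ⟨z, hz, hz1, hz2, hz3⟩ := ((mem_closure_iff_frequently.1 hp.1).and_eventually hev).exists
    have := hmem _ _ hz1 hz2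
    rw [show (p + c * (⟨(T z).re, (T z).im⟩ : ℂ)) = z by
      rw [Complex.eta]; simp only [T]; field_simp; ring] at this
    exact absurd (this.1 hz) (not_lt.2 hz3.le)
  have hM : 0 < (M : ℝ) + 1 := by positivity
  let C : FlatChart K :=
    -- With this width `|f x| ≤ M|x| < h/2`, so `f x + t` stays in the range `|y| < h` for `|t| <
    -- h/2`.
    { p := p, c := c, f := f, M := M, r := min r (h / 2 / (M + 1)), δ := h / 2
      norm_c := hc
      lip := hf
      r_pos := by positivity
      δ_pos := by positivity
      mem_iff' := by
        intro x t hx ht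
        have h1 : |f x| ≤ M * |x| := by
          have := hf.dist_le_mul x 0
          simpa [hf0, Real.dist_eq] using this
        have h2 : |x| < h / 2 / (M + 1) := hx.trans_le (min_le_right _ _)
        rw [lt_div_iff₀ hM] at h2
        have h3 : |f x + t| < h := by
          calc |f x + t| ≤ |f x| + |t| := abs_add_le _ _
            _ < h := by nlinarith [abs_nonneg x]
        rw [hmem x _ (hx.trans_le (min_le_left _ _)) h3]
        exact ⟨fun h => by linarith, fun h => by linarith⟩ }
  refine ⟨C, ?_⟩
  have : C.map (0, 0) = p := by
    rw [C.map_apply']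
    simp [C, hf0]
  rw [← this, C.mem_box_iff]
  simpa using ⟨C.r_pos, C.δ_pos⟩

/-! ### The divergence theorem in flattened coordinates -/

/-- Integration by parts for Lipschitz functions, against the constant `1`. -/
theorem LipschitzWith.integral_deriv_eq_zero {g : ℝ → ℝ} {M : ℝ≥0} (hg : LipschitzWith M g)
    (hc : HasCompactSupport g) : ∫ x, deriv g x = 0 := by
  have h := LipschitzWith.integral_lineDeriv_mul_eq (μ := volume) (f := fun _ : ℝ => (1 : ℝ)) (C := 0)
    (LipschitzWith.const 1) hg hc (-1)
  have h1 : ∀ x, lineDeriv ℝ g x 1 = deriv g x := fun x => by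
    simp only [lineDeriv, smul_eq_mul, mul_one]
    simpa using deriv_comp_const_add (f := g) x 0
  have h2 : ∀ x, lineDeriv ℝ (fun _ : ℝ => (1 : ℝ)) x (-1) = 0 := fun x => by simp [lineDeriv]
  simp only [neg_neg, h1, h2, mul_one, zero_mul, integral_zero] at h
  exact h.symm

namespace FlatChart

variable {K : Set ℂ} (C : FlatChart K)

/-- Integrals over `K` in the flattened coordinates. -/
theorem setIntegral_eq (hK : IsOpen K) {g : ℂ → ℝ} (hg : Integrable g) (h0 : ∀ z ∉ C.box, g z = 0) :
    ∫ z in K, g z = ∫ x, ∫ t in Ioi 0, g (C.map (x, t)) := by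
  have h1 : Integrable (fun q => g (C.map q)) (volume.prod volume) :=
    (C.measurePreserving_map.integrable_comp_emb C.map.measurableEmbedding).2 hg
  rw [← integral_indicator hK.measurableSet,
    ← C.measurePreserving_map.integral_comp C.map.measurableEmbedding]
  have h2 : ∀ q : ℝ × ℝ, K.indicator g (C.map q) =
      (univ ×ˢ Ioi (0 : ℝ)).indicator (fun q => g (C.map q)) q := by
    rintro ⟨x, t⟩
    by_cases hb : C.map (x, t) ∈ C.box
    · obtain ⟨hx, ht⟩ := C.mem_box_iff.1 hb
      simp only [indicator, C.mem_iff hx ht, mem_prod, mem_univ, true_and, mem_Ioi]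
    · simp only [indicator, h0 _ hb, ite_self]
  simp_rw [h2]
  rw [integral_indicator (MeasurableSet.univ.prod measurableSet_Ioi), Measure.volume_eq_prod,
    setIntegral_prod _ h1.integrableOn]
  simp

theorem hasDerivAt_map_snd (x t : ℝ) :
    HasDerivAt (fun s => C.map (x, s)) (C.c * Complex.I) t := by
  simp_rw [C.map_apply']
  have : HasDerivAt (fun s : ℝ => ((s : ℝ) : ℂ)) 1 t := Complex.ofRealCLM.hasDerivAt
  simpa using (((this.const_add (C.f x : ℂ)).mul_const (C.c * Complex.I))).const_add
    (C.p + x * C.c)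

theorem hasDerivAt_map_fst {x f' : ℝ} (t : ℝ) (hf : HasDerivAt C.f f' x) :
    HasDerivAt (fun y => C.map (y, t)) (C.c + f' * (C.c * Complex.I)) x := by
  simp_rw [C.map_apply']
  have h1 : HasDerivAt (fun s : ℝ => ((s : ℝ) : ℂ)) 1 x := Complex.ofRealCLM.hasDerivAt
  have h2 := hf.ofReal_comp
  simpa using ((h1.mul_const C.c).const_add C.p).fun_add
    ((h2.add_const (t : ℂ)).mul_const (C.c * Complex.I))

variable {v : ℂ → ℝ}

theorem hasDerivAt_comp_snd (hv : ContDiff ℝ 1 v) (x t : ℝ) :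
    HasDerivAt (fun s => v (C.map (x, s))) (fderiv ℝ v (C.map (x, t)) (C.c * Complex.I)) t :=
  ((hv.differentiable one_ne_zero _).hasFDerivAt).comp_hasDerivAt t (C.hasDerivAt_map_snd x t)

theorem hasCompactSupport_comp_snd (hv : HasCompactSupport v) (x : ℝ) :
    HasCompactSupport fun s => v (C.map (x, s)) := by
  refine hv.comp_isClosedEmbedding (C.map.isClosedEmbedding.comp ?_)
  exact ⟨isEmbedding_prodMkRight x, by
    convert (isClosed_singleton (x := x)).prod (isClosed_univ (X := ℝ))
    ext ⟨a, b⟩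
    simp [eq_comm]⟩

theorem hasCompactSupport_comp_fst (hv : HasCompactSupport v) (t : ℝ) :
    HasCompactSupport fun y => v (C.map (y, t)) := by
  refine hv.comp_isClosedEmbedding (C.map.isClosedEmbedding.comp ?_)
  exact ⟨isEmbedding_prodMkLeft t, by
    convert (isClosed_univ (X := ℝ)).prod (isClosed_singleton (x := t))
    ext ⟨a, b⟩
    simp [eq_comm]⟩

theorem continuous_fderiv_apply (hv : ContDiff ℝ 1 v) (e : ℂ) :
    Continuous fun z => fderiv ℝ v z e :=
  (hv.continuous_fderiv one_ne_zero).clm_apply continuous_const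

theorem integrable_fderiv_apply (hv : ContDiff ℝ 1 v) (hc : HasCompactSupport v) (e : ℂ) :
    Integrable fun z => fderiv ℝ v z e :=
  (continuous_fderiv_apply hv e).integrable_of_hasCompactSupport (hc.fderiv_apply ℝ e)

theorem integral_Ioi_fderiv (hv : ContDiff ℝ 1 v) (hc : HasCompactSupport v) (x : ℝ) :
    ∫ t in Ioi 0, fderiv ℝ v (C.map (x, t)) (C.c * Complex.I) = -v (C.map (x, 0)) := by
  have h : ∀ t, fderiv ℝ v (C.map (x, t)) (C.c * Complex.I) = deriv (fun s => v (C.map (x, s))) t :=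
    fun t => (C.hasDerivAt_comp_snd hv x t).deriv.symm
  simp_rw [h]
  refine HasCompactSupport.integral_Ioi_deriv_eq ?_ (C.hasCompactSupport_comp_snd hc x) 0
  refine hv.comp ?_
  simp_rw [C.map_apply']
  have : ContDiff ℝ 1 (fun s : ℝ => (s : ℂ)) := Complex.ofRealCLM.contDiff
  fun_prop

theorem fderiv_eq_zero_of_notMem_box (hb : tsupport v ⊆ C.box) (e : ℂ) {z : ℂ}
    (hz : z ∉ C.box) : fderiv ℝ v z e = 0 := by
  have : fderiv ℝ v z = 0 := by
    by_contra h
    exact hz (hb (support_fderiv_subset ℝ h))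
  simp [this]

theorem setIntegral_fderiv_normal (hK : IsOpen K) (hv : ContDiff ℝ 1 v) (hc : HasCompactSupport v)
    (hb : tsupport v ⊆ C.box) :
    ∫ z in K, fderiv ℝ v z (C.c * Complex.I) = -∫ x, v (C.map (x, 0)) := by
  rw [C.setIntegral_eq hK (integrable_fderiv_apply hv hc _)
    fun z hz => C.fderiv_eq_zero_of_notMem_box hb _ hz, ← integral_neg]
  exact integral_congr_ae (Eventually.of_forall fun x => C.integral_Ioi_fderiv hv hc x)

theorem ae_hasDerivAt : ∀ᵐ x, HasDerivAt C.f (deriv C.f x) x := by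
  filter_upwards [C.lip.ae_differentiableAt_of_real] with x hx using hx.hasDerivAt

theorem abs_deriv_le (x : ℝ) : |deriv C.f x| ≤ C.M := norm_deriv_le_of_lipschitz C.lip

theorem lipschitzWith_map_fst (t : ℝ) : LipschitzWith (1 + C.M) fun y => C.map (y, t) := by
  refine LipschitzWith.of_dist_le_mul fun y y' => ?_
  have h1 : C.map (y, t) - C.map (y', t) =
      C.c * (((y - y' : ℝ) : ℂ) + ((C.f y - C.f y' : ℝ) : ℂ) * Complex.I) := by
    simp only [C.map_apply']; push_cast; ring
  rw [dist_eq_norm, h1, norm_mul, C.norm_c, one_mul]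
  refine (norm_add_le _ _).trans ?_
  rw [norm_mul, Complex.norm_I, mul_one, Complex.norm_real, Complex.norm_real]
  have h2 := C.lip.dist_le_mul y y'
  simp only [Real.dist_eq, Real.norm_eq_abs, NNReal.coe_add, NNReal.coe_one] at *
  linarith

/-- On a horizontal line `v ∘ C.map` is only Lipschitz, as `f` is. Its derivative still integrates
to zero, and where `f` is differentiable, hence almost everywhere, the chain rule gives the two
terms. -/
theorem integral_fderiv_fst (hv : ContDiff ℝ 1 v) (hc : HasCompactSupport v) (t : ℝ) :
    ∫ x, fderiv ℝ v (C.map (x, t)) C.c =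
      -∫ x, deriv C.f x * fderiv ℝ v (C.map (x, t)) (C.c * Complex.I) := by
  obtain ⟨D, hD⟩ := hv.lipschitzWith_of_hasCompactSupport hc one_ne_zero
  have h0 := (hD.comp (C.lipschitzWith_map_fst t)).integral_deriv_eq_zero
    (C.hasCompactSupport_comp_fst hc t)
  have hcont : Continuous fun x => C.map (x, t) := (C.lipschitzWith_map_fst t).continuous
  have hint : ∀ e : ℂ, Integrable fun x => fderiv ℝ v (C.map (x, t)) e := fun e =>
    ((continuous_fderiv_apply hv e).comp hcont).integrable_of_hasCompactSupport
      (C.hasCompactSupport_comp_fst (hc.fderiv_apply ℝ e) t)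
  have hint' : Integrable fun x => deriv C.f x * fderiv ℝ v (C.map (x, t)) (C.c * Complex.I) :=
    (hint _).bdd_mul (measurable_deriv C.f).aestronglyMeasurable
      (Eventually.of_forall fun x => C.abs_deriv_le x)
  rw [eq_neg_iff_add_eq_zero, ← integral_add (hint _) hint', ← h0]
  refine integral_congr_ae ?_
  filter_upwards [C.ae_hasDerivAt] with x hx
  have := ((hv.differentiable one_ne_zero _).hasFDerivAt).comp_hasDerivAt x
    (C.hasDerivAt_map_fst t hx)
  change _ = deriv (v ∘ fun y => C.map (y, t)) x
  rw [this.deriv, _root_.map_add, ← Complex.real_smul, map_smul, smul_eq_mul]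

/-- Integrating along `x` first trades the derivative along `c` for `-f'` times the derivative along
`ci`. After swapping back, the integral in `t` leaves only the value at `t = 0`. -/
theorem setIntegral_fderiv_tangent (hK : IsOpen K) (hv : ContDiff ℝ 1 v) (hc : HasCompactSupport v)
    (hb : tsupport v ⊆ C.box) :
    ∫ z in K, fderiv ℝ v z C.c = ∫ x, deriv C.f x * v (C.map (x, 0)) := by
  have hint : ∀ e : ℂ, Integrable (fun q => fderiv ℝ v (C.map q) e) (volume.prod volume) := fun e =>
    (C.measurePreserving_map.integrable_comp_emb C.map.measurableEmbedding).2
      (integrable_fderiv_apply hv hc e)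
  have hint' : Integrable
      (fun q : ℝ × ℝ => deriv C.f q.1 * fderiv ℝ v (C.map q) (C.c * Complex.I))
      (volume.prod volume) :=
    (hint _).bdd_mul ((measurable_deriv C.f).comp measurable_fst).aestronglyMeasurable
      (Eventually.of_forall fun q => C.abs_deriv_le q.1)
  -- Both applications of Fubini are over the half-plane `t > 0`, where integrability is inherited
  -- from the plane.
  have hle : (volume : Measure ℝ).prod (volume.restrict (Ioi (0 : ℝ))) ≤ volume.prod volume := by
    have := Measure.prod_restrict (μ := (volume : Measure ℝ)) (ν := (volume : Measure ℝ)) univ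
      (Ioi 0)
    rw [Measure.restrict_univ] at this
    rw [this]
    exact Measure.restrict_le_self
  rw [C.setIntegral_eq hK (integrable_fderiv_apply hv hc _)
    fun z hz => C.fderiv_eq_zero_of_notMem_box hb _ hz]
  rw [integral_integral_swap (f := fun x t => fderiv ℝ v (C.map (x, t)) C.c)
    ((hint C.c).mono_measure hle)]
  simp_rw [C.integral_fderiv_fst hv hc]
  rw [integral_neg, ← integral_integral_swap
    (f := fun x t => deriv C.f x * fderiv ℝ v (C.map (x, t)) (C.c * Complex.I))
    (hint'.mono_measure hle), ← integral_neg]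
  refine integral_congr_ae (Eventually.of_forall fun x => ?_)
  simp only
  rw [integral_const_mul, C.integral_Ioi_fderiv hv hc]
  ring

end FlatChart

/-! ### Edges as pieces of the graph in a chart -/

namespace FlatChart

variable {K : Set ℂ} (C : FlatChart K)

/-- The rotated coordinates `x + i y` of the chart, before the shear. -/
noncomputable def coord (z : ℂ) : ℂ := star C.c * (z - C.p)

theorem star_c_mul_c : star C.c * C.c = 1 := by
  have := Complex.conj_mul' C.c
  rw [C.norm_c] at this
  simpa using this

theorem coord_map (x t : ℝ) : C.coord (C.map (x, t)) = ⟨x, C.f x + t⟩ := by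
  rw [coord, map_apply, add_sub_cancel_left, ← mul_assoc, C.star_c_mul_c, one_mul]

theorem map_coord (z : ℂ) : C.map ((C.coord z).re, (C.coord z).im - C.f (C.coord z).re) = z := by
  obtain ⟨x, t, rfl⟩ := C.exists_map_eq z
  simp [C.coord_map]

theorem continuous_coord : Continuous C.coord := by
  unfold coord; fun_prop

theorem mem_box_iff_coord {z : ℂ} : z ∈ C.box ↔
    |(C.coord z).re| < C.r ∧ |(C.coord z).im - C.f (C.coord z).re| < C.δ := by
  rw [← C.mem_box_iff, C.map_coord]

theorem mem_iff_coord {z : ℂ} (hz : z ∈ C.box) : z ∈ K ↔ C.f (C.coord z).re < (C.coord z).im := by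
  obtain ⟨h1, h2⟩ := C.mem_box_iff_coord.1 hz
  have := C.mem_iff h1 h2
  rwa [C.map_coord, sub_pos] at this

theorem coord_im_of_mem_frontier (hK : IsOpen K) {z : ℂ} (hz : z ∈ C.box) (hf : z ∈ frontier K) :
    (C.coord z).im = C.f (C.coord z).re := by
  obtain ⟨h1, h2⟩ := C.mem_box_iff_coord.1 hz
  have := (C.mem_frontier_iff hK h1 h2).1 (by rwa [C.map_coord])
  linarith

theorem map_coord_re_of_mem_frontier (hK : IsOpen K) {z : ℂ} (hz : z ∈ C.box)
    (hf : z ∈ frontier K) : C.map ((C.coord z).re, 0) = z := by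
  have := C.coord_im_of_mem_frontier hK hz hf
  conv_rhs => rw [← C.map_coord z, this, sub_self]

end FlatChart

namespace CurvilinearPolygon

variable (P : CurvilinearPolygon) (C : FlatChart P.carrier)

theorem edge_mem_frontier (i : Fin P.numEdges) {s : ℝ} (hs : s ∈ Icc 0 (P.len i)) :
    P.edge i s ∈ frontier P.carrier := by
  rw [P.frontier_eq]
  exact mem_iUnion_of_mem i ⟨s, hs, rfl⟩

/-- The parameters of the `i`-th edge that are mapped into the domain of a chart. -/
def paramSet (i : Fin P.numEdges) : Set ℝ := Ioo 0 (P.len i) ∩ P.edge i ⁻¹' C.box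

theorem isOpen_paramSet (i : Fin P.numEdges) : IsOpen (P.paramSet C i) :=
  isOpen_Ioo.inter (C.isOpen_box.preimage (P.contDiff_edge i).continuous)

/-- The first chart coordinate along the `i`-th edge. -/
noncomputable def edgeX (i : Fin P.numEdges) (s : ℝ) : ℝ := (C.coord (P.edge i s)).re

/-- The tangent in the rotated coordinates of a chart. -/
noncomputable def chartTangent (i : Fin P.numEdges) (s : ℝ) : ℂ := star C.c * P.tangent i s

variable {P C} {i : Fin P.numEdges} {s : ℝ}

theorem hasStrictDerivAt_coord_edge :
    HasStrictDerivAt (fun s => C.coord (P.edge i s)) (P.chartTangent C i s) s :=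
  HasStrictDerivAt.const_mul (star C.c)
    (((P.contDiff_edge i).contDiffAt.hasStrictDerivAt one_ne_zero).sub_const C.p)

theorem hasStrictDerivAt_edgeX :
    HasStrictDerivAt (P.edgeX C i) (P.chartTangent C i s).re s :=
  Complex.reCLM.hasStrictFDerivAt.comp_hasStrictDerivAt s hasStrictDerivAt_coord_edge

theorem hasDerivAt_coord_edge_im :
    HasDerivAt (fun s => (C.coord (P.edge i s)).im) (P.chartTangent C i s).im s :=
  (Complex.imCLM.hasStrictFDerivAt.comp_hasStrictDerivAt s hasStrictDerivAt_coord_edge).hasDerivAt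

theorem mem_frontier_of_mem_paramSet (hs : s ∈ P.paramSet C i) :
    P.edge i s ∈ frontier P.carrier :=
  P.edge_mem_frontier i ⟨hs.1.1.le, hs.1.2.le⟩

theorem map_edgeX (hs : s ∈ P.paramSet C i) : C.map (P.edgeX C i s, 0) = P.edge i s :=
  C.map_coord_re_of_mem_frontier P.isOpen hs.2 (mem_frontier_of_mem_paramSet hs)

theorem abs_edgeX_lt (hs : s ∈ P.paramSet C i) : |P.edgeX C i s| < C.r :=
  (C.mem_box_iff_coord.1 hs.2).1

theorem coord_edge_im (hs : s ∈ P.paramSet C i) :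
    (C.coord (P.edge i s)).im = C.f (P.edgeX C i s) :=
  C.coord_im_of_mem_frontier P.isOpen hs.2 (mem_frontier_of_mem_paramSet hs)

theorem eventually_coord_edge_im (hs : s ∈ P.paramSet C i) :
    ∀ᶠ s' in 𝓝 s, (C.coord (P.edge i s')).im = C.f (P.edgeX C i s') := by
  filter_upwards [(P.isOpen_paramSet C i).mem_nhds hs] with s' hs' using coord_edge_im hs'

theorem norm_chartTangent (hs : s ∈ P.paramSet C i) :
    (P.chartTangent C i s).re ^ 2 + (P.chartTangent C i s).im ^ 2 = 1 := by
  have h1 : ‖P.chartTangent C i s‖ = 1 := by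
    rw [chartTangent, norm_mul, norm_star, C.norm_c, tangent,
      P.unit_speed i s ⟨hs.1.1.le, hs.1.2.le⟩, one_mul]
  have h2 := Complex.sq_norm (P.chartTangent C i s)
  rw [h1, Complex.normSq_apply] at h2
  linarith

/-- The edge runs on the graph of an `M`-Lipschitz function, so the difference quotients of its
coordinates satisfy this bound, and so do their limits. -/
theorem abs_chartTangent_im_le (hs : s ∈ P.paramSet C i) :
    |(P.chartTangent C i s).im| ≤ C.M * |(P.chartTangent C i s).re| := by
  have h1 := (hasDerivAt_iff_tendsto_slope.1 (hasDerivAt_coord_edge_im (C := C) (i := i) (s := s))).abs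
  have h2 := ((hasDerivAt_iff_tendsto_slope.1
    (hasStrictDerivAt_edgeX (C := C) (i := i) (s := s)).hasDerivAt).abs).const_mul (C.M : ℝ)
  refine le_of_tendsto_of_tendsto h1 h2 ?_
  filter_upwards [(eventually_coord_edge_im hs).filter_mono nhdsWithin_le_nhds] with s' hs'
  rw [slope_def_field, slope_def_field, hs', coord_edge_im hs, abs_div, abs_div, ← mul_div_assoc]
  gcongr
  exact C.lip.dist_le_mul _ _

theorem chartTangent_re_ne_zero (hs : s ∈ P.paramSet C i) : (P.chartTangent C i s).re ≠ 0 := by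
  intro h
  have h1 := norm_chartTangent hs
  have h2 := abs_chartTangent_im_le hs
  rw [h, abs_zero, mul_zero] at h2
  have h3 : (P.chartTangent C i s).im = 0 := abs_nonpos_iff.1 h2
  rw [h, h3] at h1
  norm_num at h1

/-- A priori `f` is only Lipschitz. Since the first coordinate of the edge has nonzero strict
derivative, it has a local inverse, and `f` is locally the second coordinate composed with that
inverse. -/
theorem hasDerivAt_graph (hs : s ∈ P.paramSet C i) :
    HasDerivAt C.f ((P.chartTangent C i s).im / (P.chartTangent C i s).re) (P.edgeX C i s) := by
  have h0 := chartTangent_re_ne_zero hs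
  have hX := hasStrictDerivAt_edgeX (P := P) (C := C) (i := i) (s := s)
  have hX' := hX.hasStrictFDerivAt_equiv h0
  have hg := hX.to_localInverse h0
  set g := hX.localInverse (P.edgeX C i) _ s h0 with hgdef
  have hgs : g (P.edgeX C i s) = s := hX'.localInverse_apply_image
  have hr : ∀ᶠ ξ in 𝓝 (P.edgeX C i s), P.edgeX C i (g ξ) = ξ := hX'.eventually_right_inverse
  have hgt : Tendsto g (𝓝 (P.edgeX C i s)) (𝓝 s) := by
    have := hg.hasDerivAt.continuousAt.tendsto
    rwa [hgs] at this
  have hy : HasDerivAt (fun s => (C.coord (P.edge i s)).im) (P.chartTangent C i s).im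
      (g (P.edgeX C i s)) := by
    rw [hgs]; exact hasDerivAt_coord_edge_im
  have hc := hy.comp _ hg.hasDerivAt
  rw [div_eq_mul_inv]
  refine hc.congr_of_eventuallyEq ?_
  filter_upwards [hr, hgt.eventually (eventually_coord_edge_im hs)] with ξ h1 h2
  rw [Function.comp_apply, h2, h1]

/-- `K` lies above the graph and to the left of the tangent, so the tangent points to the right. -/
theorem chartTangent_re_pos (hs : s ∈ P.paramSet C i) : 0 < (P.chartTangent C i s).re := by
  have h0 := chartTangent_re_ne_zero hs
  have h1 := norm_chartTangent hs
  set a := (P.chartTangent C i s).re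
  set b := (P.chartTangent C i s).im
  set x := P.edgeX C i s
  -- Moving by `ε` along `it` leads to the chart point `(x - εb, f x + εa)`, which lies in `K` only
  -- if this function is less than `f x`. Its derivative at `0` is `-b²/a - a = -1/a`, which must
  -- therefore be nonpositive.
  have hd : HasDerivAt (fun ε : ℝ => C.f (x - ε * b) - ε * a) (-(1 / a)) 0 := by
    have e1 : HasDerivAt (fun ε : ℝ => x - ε * b) (-b) 0 := by
      simpa using ((hasDerivAt_id (0 : ℝ)).mul_const b).const_sub x
    have e2 : HasDerivAt C.f (b / a) (x - 0 * b) := by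
      simpa using hasDerivAt_graph hs
    have e3 := (e2.comp (0 : ℝ) e1).sub ((hasDerivAt_id (0 : ℝ)).mul_const a)
    refine e3.congr_deriv ?_
    field_simp
    linarith
  have hlim := (hasDerivAt_iff_tendsto_slope.1 hd).mono_left
    (nhdsWithin_mono 0 (show Ioi (0 : ℝ) ⊆ {0}ᶜ from fun y hy => (ne_of_gt hy)))
  have hcont : Continuous fun ε : ℝ => P.edge i s + ε * (Complex.I * deriv (P.edge i) s) := by
    fun_prop
  have hbox : ∀ᶠ ε : ℝ in 𝓝[>] 0,
      P.edge i s + ε * (Complex.I * deriv (P.edge i) s) ∈ C.box := by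
    refine Eventually.filter_mono nhdsWithin_le_nhds
      ((hcont.tendsto 0).eventually (C.isOpen_box.mem_nhds ?_))
    simpa using hs.2
  have hle : -(1 / a) ≤ 0 := by
    refine le_of_tendsto hlim ?_
    filter_upwards [P.orientation i s hs.1, hbox, self_mem_nhdsWithin] with ε h2 h3 hε
    have h4 := (C.mem_iff_coord h3).1 h2.1
    have h5 : C.coord (P.edge i s + ε * (Complex.I * deriv (P.edge i) s)) =
        C.coord (P.edge i s) + ε * (Complex.I * P.chartTangent C i s) := by
      simp only [FlatChart.coord, chartTangent, tangent]; ring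
    have h6 : (C.coord (P.edge i s + ε * (Complex.I * deriv (P.edge i) s))).re = x - ε * b := by
      rw [h5]; simp [x, b, edgeX]; ring
    have h7 : (C.coord (P.edge i s + ε * (Complex.I * deriv (P.edge i) s))).im =
        C.f x + ε * a := by
      rw [h5, ← coord_edge_im hs]; simp [a]
    rw [h6, h7] at h4
    rw [slope_def_field]
    refine div_nonpos_of_nonpos_of_nonneg ?_ (by simpa using (le_of_lt hε))
    simp only [zero_mul, sub_zero]
    linarith
  have : 0 ≤ 1 / a := by linarith
  exact lt_of_le_of_ne (by simpa using this) (Ne.symm h0)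

/-- With tangent `(a, b)`: `1 = a² + b² ≤ (1 + M²)a² ≤ ((1 + M)a)²`. This is the bound `ds ≤ (1 + M)
dx`. -/
theorem one_le_mul_chartTangent_re (hs : s ∈ P.paramSet C i) :
    1 ≤ (1 + C.M) * (P.chartTangent C i s).re := by
  have h0 := chartTangent_re_pos hs
  have h1 := norm_chartTangent hs
  have h2 := abs_chartTangent_im_le hs
  rw [abs_of_pos h0] at h2
  have h3 : (P.chartTangent C i s).im ^ 2 ≤ (C.M * (P.chartTangent C i s).re) ^ 2 := by
    rw [← sq_abs (P.chartTangent C i s).im]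
    gcongr
  have hM : (0 : ℝ) ≤ C.M := C.M.2
  have h4 : 1 ≤ ((1 + C.M) * (P.chartTangent C i s).re) ^ 2 := by
    nlinarith [mul_nonneg hM (sq_nonneg (P.chartTangent C i s).re)]
  nlinarith [mul_nonneg hM h0.le]

theorem injOn_edgeX : InjOn (P.edgeX C i) (P.paramSet C i) := by
  intro s hs s' hs' h
  refine P.injOn_edge i ⟨hs.1.1.le, hs.1.2.le⟩ ⟨hs'.1.1.le, hs'.1.2.le⟩ ?_
  rw [← map_edgeX hs, ← map_edgeX hs', h]

/-- A boundary point in the box is determined by its abscissa, so a common abscissa would be a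
common point of two edges. -/
theorem pairwise_disjoint_image_edgeX :
    Pairwise (Function.onFun Disjoint fun i => P.edgeX C i '' P.paramSet C i) := by
  intro i j hij
  rw [Function.onFun, Set.disjoint_left]
  rintro _ ⟨s, hs, rfl⟩ ⟨s', hs', h⟩
  refine Set.disjoint_left.1 (P.disjoint_edges i j hij) ⟨s, hs.1, rfl⟩
    ⟨s', ⟨hs'.1.1.le, hs'.1.2.le⟩, ?_⟩
  rw [← map_edgeX hs, ← map_edgeX hs', h]

theorem iUnion_image_edgeX_subset : ⋃ i, P.edgeX C i '' P.paramSet C i ⊆ Ioo (-C.r) C.r := by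
  refine iUnion_subset fun i => ?_
  rintro _ ⟨s, hs, rfl⟩
  exact abs_lt.1 (abs_edgeX_lt hs)

/-- Above each abscissa lies a boundary point, hence a point of some edge. The parameter sets leave
out only the end points of the edges, finitely many. -/
theorem iUnion_image_edgeX_ae_eq :
    (⋃ i, P.edgeX C i '' P.paramSet C i : Set ℝ) =ᵐ[volume] Ioo (-C.r) C.r := by
  refine (LE.le.eventuallyLE iUnion_image_edgeX_subset).antisymm ?_
  have hfin : (⋃ i, {P.edgeX C i 0, P.edgeX C i (P.len i)} : Set ℝ).Finite :=
    finite_iUnion fun i => by simp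
  filter_upwards [compl_mem_ae_iff.2 (hfin.measure_zero volume)] with x hx hxr
  have hx' : |x| < C.r := abs_lt.2 hxr
  have hf := (C.mem_frontier_iff P.isOpen hx' (by simpa using C.δ_pos)).2 rfl
  have hbox : C.map (x, 0) ∈ C.box := C.mem_box_iff.2 ⟨hx', by simpa using C.δ_pos⟩
  rw [P.frontier_eq] at hf
  obtain ⟨i, s, hs, hsx⟩ := mem_iUnion.1 hf
  have hxs : P.edgeX C i s = x := by
    rw [edgeX, hsx, C.coord_map]
  refine mem_iUnion.2 ⟨i, s, ⟨⟨lt_of_le_of_ne hs.1 ?_, lt_of_le_of_ne hs.2 ?_⟩, ?_⟩, hxs⟩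
  · rintro rfl
    exact hx (mem_iUnion.2 ⟨i, by simp [hxs]⟩)
  · rintro rfl
    exact hx (mem_iUnion.2 ⟨i, by simp [hxs]⟩)
  · rwa [mem_preimage, hsx]

theorem measurableSet_image_edgeX (i : Fin P.numEdges) :
    MeasurableSet (P.edgeX C i '' P.paramSet C i) :=
  (P.isOpen_paramSet C i).measurableSet.image_of_continuousOn_injOn
    (fun _ _ => hasStrictDerivAt_edgeX.hasDerivAt.continuousAt.continuousWithinAt) injOn_edgeX

/-- Integrals over the part of the boundary in a chart, in terms of the chart coordinate. -/
theorem sum_integral_paramSet {F : ℝ → ℝ} (hF : IntegrableOn F (Ioo (-C.r) C.r)) :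
    ∑ i, ∫ s in P.paramSet C i, (P.chartTangent C i s).re * F (P.edgeX C i s) =
      ∫ x in Ioo (-C.r) C.r, F x := by
  rw [← setIntegral_congr_set (iUnion_image_edgeX_ae_eq (P := P) (C := C)),
    integral_iUnion_fintype measurableSet_image_edgeX pairwise_disjoint_image_edgeX
      (fun i => hF.mono_set ((subset_iUnion _ i).trans iUnion_image_edgeX_subset))]
  refine Finset.sum_congr rfl fun i _ => ?_
  rw [integral_image_eq_integral_abs_deriv_smul (P.isOpen_paramSet C i).measurableSet
    (fun s _ => hasStrictDerivAt_edgeX.hasDerivAt.hasDerivWithinAt) injOn_edgeX]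
  refine setIntegral_congr_fun (P.isOpen_paramSet C i).measurableSet fun s hs => ?_
  simp only [abs_of_pos (chartTangent_re_pos hs), smul_eq_mul]

/-- Arc length is controlled by the chart coordinate. -/
theorem lintegral_paramSet_le (F : ℝ → ENNReal) (i : Fin P.numEdges) :
    ∫⁻ s in P.paramSet C i, F (P.edgeX C i s) ≤
      ENNReal.ofReal (1 + C.M) * ∫⁻ x in Ioo (-C.r) C.r, F x := by
  have h1 : ∫⁻ x in P.edgeX C i '' P.paramSet C i, F x ≤ ∫⁻ x in Ioo (-C.r) C.r, F x :=
    lintegral_mono_set ((subset_iUnion _ i).trans iUnion_image_edgeX_subset)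
  rw [lintegral_image_eq_lintegral_abs_deriv_mul (P.isOpen_paramSet C i).measurableSet
    (fun s _ => hasStrictDerivAt_edgeX.hasDerivAt.hasDerivWithinAt) injOn_edgeX] at h1
  refine le_trans ?_ (mul_le_mul_right h1 _)
  rw [← lintegral_const_mul' _ _ ENNReal.ofReal_ne_top]
  refine setLIntegral_mono' (P.isOpen_paramSet C i).measurableSet fun s hs => ?_
  rw [← mul_assoc, ← ENNReal.ofReal_mul (by positivity), abs_of_pos (chartTangent_re_pos hs)]
  exact le_mul_of_one_le_left zero_le
    (ENNReal.one_le_ofReal.2 (one_le_mul_chartTangent_re hs))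

end CurvilinearPolygon

/-! ### The divergence theorem in a curvilinear polygon -/

open scoped Manifold

theorem integral_fderiv_eq_zero {v : ℂ → ℝ} (hv : ContDiff ℝ 1 v) (hc : HasCompactSupport v)
    (e : ℂ) : ∫ z, fderiv ℝ v z e = 0 := by
  have h := integral_mul_fderiv_eq_neg_fderiv_mul_of_integrable (𝕜 := ℝ) (μ := volume) (v := e)
    (f := fun _ : ℂ => (1 : ℝ)) (g := v) (by simp)
    (by simpa using FlatChart.integrable_fderiv_apply hv hc e)
    (by simpa using hv.continuous.integrable_of_hasCompactSupport hc) (by fun_prop)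
    (fun z _ => hv.differentiable one_ne_zero z)
  simpa using h

namespace CurvilinearPolygon

variable (P : CurvilinearPolygon)

theorem isCompact_closure : IsCompact (closure P.carrier) := P.isBounded.isCompact_closure

theorem isCompact_frontier : IsCompact (frontier P.carrier) :=
  P.isCompact_closure.of_isClosed_subset isClosed_frontier frontier_subset_closure

/-- A smooth partition of unity on the closure of `K`, each member of which is supported in `K` or
in the domain of a flattening chart. -/
theorem exists_partitionOfUnity : ∃ (ι : Type) (_ : Fintype ι) (η : ι → ℂ → ℝ),
    (∀ j, ContDiff ℝ ∞ (η j)) ∧ (∀ j, HasCompactSupport (η j)) ∧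
    (∀ j, tsupport (η j) ⊆ P.carrier ∨ ∃ C : FlatChart P.carrier, tsupport (η j) ⊆ C.box) ∧
    ∀ z ∈ closure P.carrier, ∑ j, η j z = 1 := by
  have hC : ∀ p : frontier P.carrier, ∃ C : FlatChart P.carrier, (p : ℂ) ∈ C.box := fun p =>
    P.hasLipschitzBoundary.exists_flatChart P.isOpen p.2
  choose C hC using hC
  obtain ⟨t, ht⟩ := P.isCompact_frontier.elim_finite_subcover
    (fun p : frontier P.carrier => (C p).box) (fun p => (C p).isOpen_box)
    (fun p hp => mem_iUnion.2 ⟨⟨p, hp⟩, hC ⟨p, hp⟩⟩)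
  -- Intersecting the cover with this ball makes the supports compact.
  obtain ⟨R, hR⟩ := P.isCompact_closure.isBounded.subset_ball 0
  let U : Option t → Set ℂ := fun o => (o.elim P.carrier fun p => (C p).box) ∩ Metric.ball 0 R
  have hU : ∀ o, IsOpen (U o) := by
    rintro (_ | p)
    · exact P.isOpen.inter Metric.isOpen_ball
    · exact (C p).isOpen_box.inter Metric.isOpen_ball
  have hcov : closure P.carrier ⊆ ⋃ o, U o := by
    intro z hz
    by_cases hzK : z ∈ P.carrier
    · exact mem_iUnion.2 ⟨none, hzK, hR hz⟩
    · have hzf : z ∈ frontier P.carrier := by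
        rw [P.isOpen.frontier_eq]; exact ⟨hz, hzK⟩
      obtain ⟨p, hp⟩ := mem_iUnion.1 (ht hzf)
      obtain ⟨hpt, hp⟩ := mem_iUnion.1 hp
      exact mem_iUnion.2 ⟨some ⟨p, hpt⟩, hp, hR hz⟩
  obtain ⟨ψ, hψ⟩ := SmoothPartitionOfUnity.exists_isSubordinate 𝓘(ℝ, ℂ) isClosed_closure U hU hcov
  refine ⟨Fin (Fintype.card (Option t)), inferInstance,
    fun j => ψ ((Fintype.equivFin (Option t)).symm j), fun j => ?_, fun j => ?_, fun j => ?_, ?_⟩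
  · exact (ψ _).contMDiff.contDiff
  · exact (isCompact_closedBall (0 : ℂ) R).of_isClosed_subset (isClosed_tsupport _)
      (((hψ _).trans inter_subset_right).trans Metric.ball_subset_closedBall)
  · have h := (hψ ((Fintype.equivFin (Option t)).symm j)).trans inter_subset_left
    beta_reduce
    generalize (Fintype.equivFin (Option t)).symm j = o at h ⊢
    rcases o with _ | p
    · exact Or.inl h
    · exact Or.inr ⟨C p, h⟩
  · intro z hz
    have h := ψ.sum_eq_one hz
    rw [finsum_eq_sum_of_fintype] at h
    rw [← h]
    exact Equiv.sum_comp (Fintype.equivFin (Option t)).symm (fun o => ψ o z)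

theorem boundaryIntegral_congr {F G : Fin P.numEdges → ℝ → ℝ}
    (h : ∀ i, ∀ s ∈ Icc 0 (P.len i), F i s = G i s) :
    P.boundaryIntegral F = P.boundaryIntegral G :=
  Finset.sum_congr rfl fun i _ => setIntegral_congr_fun measurableSet_Icc (h i)

variable {P}

theorem continuous_tangent (i : Fin P.numEdges) : Continuous (P.tangent i) :=
  (P.contDiff_edge i).continuous_deriv le_rfl

theorem continuous_normal (i : Fin P.numEdges) : Continuous (P.normal i) :=
  continuous_const.mul (continuous_tangent i)

theorem continuous_edge (i : Fin P.numEdges) : Continuous (P.edge i) :=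
  (P.contDiff_edge i).continuous

/-- A boundary integral whose integrand vanishes outside the domain of a chart. -/
theorem boundaryIntegral_eq_sum_paramSet (C : FlatChart P.carrier) {F : Fin P.numEdges → ℝ → ℝ}
    (h : ∀ i s, P.edge i s ∉ C.box → F i s = 0) :
    P.boundaryIntegral F = ∑ i, ∫ s in P.paramSet C i, F i s := by
  refine Finset.sum_congr rfl fun i _ => ?_
  rw [integral_Icc_eq_integral_Ioo]
  refine (setIntegral_eq_of_subset_of_forall_sdiff_eq_zero measurableSet_Ioo inter_subset_left ?_)
  intro s hs
  exact h i s fun hb => hs.2 ⟨hs.1, hb⟩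

variable {v : ℂ → ℝ} {C : FlatChart P.carrier}

theorem sum_paramSet_eq_integral (hb : tsupport v ⊆ C.box) {F : ℝ → ℝ}
    (hF : Integrable fun x => F x * v (C.map (x, 0))) :
    ∑ i, ∫ s in P.paramSet C i, (P.chartTangent C i s).re * F (P.edgeX C i s) * v (P.edge i s) =
      ∫ x, F x * v (C.map (x, 0)) := by
  have h0 : ∀ z ∉ C.box, v z = 0 := fun z hz => image_eq_zero_of_notMem_tsupport fun h => hz (hb h)
  rw [← setIntegral_eq_integral_of_forall_compl_eq_zero (s := Ioo (-C.r) C.r),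
    ← sum_integral_paramSet (P := P) (C := C) hF.integrableOn]
  · refine Finset.sum_congr rfl fun i _ => ?_
    refine setIntegral_congr_fun (P.isOpen_paramSet C i).measurableSet fun s hs => ?_
    simp only [map_edgeX hs, mul_assoc]
  · intro x hx
    rw [h0, mul_zero]
    intro h
    exact hx (abs_lt.1 (C.mem_box_iff.1 h).1)

theorem normal_mul_star_eq (i : Fin P.numEdges) (s : ℝ) (α β : ℝ) :
    (P.normal i s * star (α * C.c + β * (C.c * Complex.I))).re =
      α * (P.chartTangent C i s).im - β * (P.chartTangent C i s).re := by
  simp [normal, chartTangent]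
  ring

/-- The divergence theorem for a function supported in the domain of a chart. -/
theorem setIntegral_fderiv_of_tsupport_subset_box (hv : ContDiff ℝ 1 v) (hc : HasCompactSupport v)
    (hb : tsupport v ⊆ C.box) (e : ℂ) :
    ∫ z in P.carrier, fderiv ℝ v z e =
      P.boundaryIntegral fun i s => (P.normal i s * star e).re * v (P.edge i s) := by
  have h0 : ∀ z ∉ C.box, v z = 0 := fun z hz => image_eq_zero_of_notMem_tsupport fun h => hz (hb h)
  -- In the frame `(c, ci)` of the chart, both directional cases are already known.
  obtain ⟨α, β, rfl⟩ : ∃ α β : ℝ, e = α * C.c + β * (C.c * Complex.I) := by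
    refine ⟨(star C.c * e).re, (star C.c * e).im, ?_⟩
    have h : e = C.c * (star C.c * e) := by
      rw [← mul_assoc, mul_comm C.c, C.star_c_mul_c, one_mul]
    conv_lhs => rw [h, ← Complex.re_add_im (star C.c * e)]
    ring
  rw [boundaryIntegral_eq_sum_paramSet C fun i s hs => by rw [h0 _ hs, mul_zero]]
  have hI : ∀ e : ℂ, IntegrableOn (fun z => fderiv ℝ v z e) P.carrier := fun e =>
    (FlatChart.integrable_fderiv_apply hv hc e).integrableOn
  have h1 : ∀ z, fderiv ℝ v z (α * C.c + β * (C.c * Complex.I)) =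
      α * fderiv ℝ v z C.c + β * fderiv ℝ v z (C.c * Complex.I) := fun z => by
    rw [map_add, ← Complex.real_smul, ← Complex.real_smul, map_smul, map_smul, smul_eq_mul,
      smul_eq_mul]
  simp_rw [h1]
  have hV : Integrable fun x => v (C.map (x, 0)) :=
    (hv.continuous.comp (C.lipschitzWith_map_fst 0).continuous).integrable_of_hasCompactSupport
      (C.hasCompactSupport_comp_fst hc 0)
  have hV' : Integrable fun x => deriv C.f x * v (C.map (x, 0)) :=
    hV.bdd_mul (measurable_deriv C.f).aestronglyMeasurable
      (Eventually.of_forall fun x => C.abs_deriv_le x)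
  have hS : Integrable fun x => (α * deriv C.f x - β) * v (C.map (x, 0)) := by
    refine ((hV'.const_mul α).sub (hV.const_mul β)).congr (Eventually.of_forall fun x => ?_)
    simp only [Pi.sub_apply]
    ring
  rw [integral_add ((hI _).const_mul α) ((hI _).const_mul β), integral_const_mul,
    integral_const_mul, C.setIntegral_fderiv_normal P.isOpen hv hc hb,
    C.setIntegral_fderiv_tangent P.isOpen hv hc hb, mul_neg, ← sub_eq_add_neg,
    ← integral_const_mul, ← integral_const_mul, ← integral_sub (hV'.const_mul α) (hV.const_mul β)]
  rw [show (fun x => α * (deriv C.f x * v (C.map (x, 0))) - β * v (C.map (x, 0))) =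
    fun x => (α * deriv C.f x - β) * v (C.map (x, 0)) by ext x; ring,
    ← sum_paramSet_eq_integral hb hS]
  refine Finset.sum_congr rfl fun i _ => ?_
  refine setIntegral_congr_fun (P.isOpen_paramSet C i).measurableSet fun s hs => ?_
  -- At an edge point `f'` is the slope of the tangent, so the factor `dx/ds` turns `αf' - β` into
  -- `n · e`.
  rw [normal_mul_star_eq, (hasDerivAt_graph hs).deriv]
  have := chartTangent_re_ne_zero hs
  field_simp

/-- Both sides vanish: `v` is zero on the frontier, and the left side is an integral over the whole
plane of a derivative with compact support. -/
theorem setIntegral_fderiv_of_tsupport_subset (hv : ContDiff ℝ 1 v) (hc : HasCompactSupport v)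
    (hb : tsupport v ⊆ P.carrier) (e : ℂ) :
    ∫ z in P.carrier, fderiv ℝ v z e =
      P.boundaryIntegral fun i s => (P.normal i s * star e).re * v (P.edge i s) := by
  rw [setIntegral_eq_integral_of_forall_compl_eq_zero, integral_fderiv_eq_zero hv hc]
  · symm
    refine Finset.sum_eq_zero fun i _ => setIntegral_eq_zero_of_forall_eq_zero fun s hs => ?_
    beta_reduce
    rw [image_eq_zero_of_notMem_tsupport (f := v), mul_zero]
    intro h
    have := P.edge_mem_frontier i hs
    rw [P.isOpen.frontier_eq] at this
    exact this.2 (hb h)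
  · intro z hz
    have : fderiv ℝ v z = 0 := by
      by_contra h
      exact hz (hb (support_fderiv_subset ℝ h))
    simp [this]

/-- The divergence theorem in a curvilinear polygon: `∫_K ∂v/∂e dx = ∫_{∂K} v (n · e) ds`. -/
theorem setIntegral_fderiv (P : CurvilinearPolygon) (hv : ContDiff ℝ 1 v) (e : ℂ) :
    ∫ z in P.carrier, fderiv ℝ v z e =
      P.boundaryIntegral fun i s => (P.normal i s * star e).re * v (P.edge i s) := by
  obtain ⟨ι, _, η, hη, hηc, hηs, hη1⟩ := P.exists_partitionOfUnity
  have hw : ∀ j, ContDiff ℝ 1 (fun z => η j z * v z) := fun j =>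
    ((hη j).of_le (by simp)).mul hv
  have hwc : ∀ j, HasCompactSupport (fun z => η j z * v z) := fun j => (hηc j).mul_right
  have hws : ∀ j, tsupport (fun z => η j z * v z) ⊆ tsupport (η j) := fun j =>
    tsupport_mul_subset_left
  have hj : ∀ j, ∫ z in P.carrier, fderiv ℝ (fun z => η j z * v z) z e =
      P.boundaryIntegral fun i s =>
        (P.normal i s * star e).re * (η j (P.edge i s) * v (P.edge i s)) := by
    intro j
    rcases hηs j with h | ⟨C, h⟩
    · exact setIntegral_fderiv_of_tsupport_subset (hw j) (hwc j) ((hws j).trans h) e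
    · exact setIntegral_fderiv_of_tsupport_subset_box (hw j) (hwc j) ((hws j).trans h) e
  have h1 : ∫ z in P.carrier, fderiv ℝ v z e =
      ∫ z in P.carrier, ∑ j, fderiv ℝ (fun z => η j z * v z) z e := by
    refine setIntegral_congr_fun P.isOpen.measurableSet fun z hz => ?_
    -- The partition sums to one only on the closure of `K`; as `K` is open, the identity holds near
    -- `z` and may be differentiated.
    have hev : v =ᶠ[𝓝 z] fun z => ∑ j, η j z * v z := by
      filter_upwards [P.isOpen.mem_nhds hz] with w hw
      rw [← Finset.sum_mul, hη1 w (subset_closure hw), one_mul]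
    rw [hev.fderiv_eq, fderiv_fun_sum fun j _ => (hw j).differentiable one_ne_zero z,
      _root_.sum_apply]
  rw [h1, integral_finsetSum _ fun j _ =>
    (FlatChart.integrable_fderiv_apply (hw j) (hwc j) e).integrableOn]
  simp_rw [hj, boundaryIntegral]
  rw [Finset.sum_comm]
  refine Finset.sum_congr rfl fun i _ => ?_
  rw [← integral_finsetSum]
  · refine setIntegral_congr_fun measurableSet_Icc fun s hs => ?_
    rw [← Finset.mul_sum, ← Finset.sum_mul,
      hη1 _ (frontier_subset_closure (P.edge_mem_frontier i hs)), one_mul]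
  · intro j _
    refine Continuous.integrableOn_Icc ?_
    exact (Complex.continuous_re.comp ((continuous_normal i).mul continuous_const)).mul
      (((hη j).continuous.comp (continuous_edge i)).mul (hv.continuous.comp (continuous_edge i)))

end CurvilinearPolygon

/-! ### Square integrable functions and smooth extension -/

open scoped ENNReal

theorem eLpNorm_two_pow_two {α : Type*} [MeasurableSpace α] (μ : Measure α) (f : α → ℝ) :
    eLpNorm f 2 μ ^ 2 = ∫⁻ x, ‖f x‖ₑ ^ 2 ∂μ := by
  have := eLpNorm_nnreal_pow_eq_lintegral (μ := μ) (f := f) (p := 2) two_ne_zero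
  simpa using this

theorem memLp_two_iff_lintegral {α : Type*} [MeasurableSpace α] {μ : Measure α} {f : α → ℝ}
    (hf : AEStronglyMeasurable f μ) : MemLp f 2 μ ↔ ∫⁻ x, ‖f x‖ₑ ^ 2 ∂μ < ⊤ := by
  rw [MemLp, ← eLpNorm_two_pow_two, ENNReal.pow_lt_top_iff]
  simp [hf]

/-- The Cauchy–Schwarz inequality on a set of finite measure. -/
theorem sq_setLIntegral_le {α : Type*} [MeasurableSpace α] {μ : Measure α} (A : Set α)
    {g : α → ℝ≥0∞} (hg : Measurable g) :
    (∫⁻ a in A, g a ∂μ) ^ 2 ≤ μ A * ∫⁻ a in A, g a ^ 2 ∂μ := by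
  have h := ENNReal.lintegral_mul_le_Lp_mul_Lq (μ.restrict A) Real.HolderConjugate.two_two
    (f := fun _ => 1) (g := g) aemeasurable_const hg.aemeasurable
  simp only [Pi.mul_apply, one_mul, lintegral_const, Measure.restrict_apply_univ,
    ENNReal.rpow_two] at h
  refine (pow_le_pow_left' h 2).trans (le_of_eq ?_)
  have key : ∀ a : ℝ≥0∞, (a ^ (1 / 2 : ℝ)) ^ 2 = a := fun a => by
    rw [← ENNReal.rpow_natCast, ← ENNReal.rpow_mul]
    norm_num
  rw [mul_pow, key, key, one_pow, one_mul]

/-- Translation is continuous in `L²`. -/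
theorem tendsto_eLpNorm_translate {f : ℂ → ℝ} (hf : MemLp f 2 volume) {a : ℕ → ℂ}
    (ha : Tendsto a atTop (𝓝 0)) :
    Tendsto (fun k => eLpNorm (fun z => f (z + a k) - f z) 2 volume) atTop (𝓝 0) := by
  have hT : Continuous fun b : ℂ => (⟨fun z => z + b, by fun_prop⟩ : C(ℂ, ℂ)) := by
    refine ContinuousMap.continuous_of_continuous_uncurry _ ?_
    change Continuous fun q : ℂ × ℂ => q.2 + q.1
    fun_prop
  have h := Filter.Tendsto.compMeasurePreservingLp (μ := volume) (ν := volume) (p := 2)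
    (l := atTop) (f := fun _ : ℕ => hf.toLp f) (f₀ := hf.toLp f)
    (g := fun k => (⟨fun z => z + a k, by fun_prop⟩ : C(ℂ, ℂ)))
    (g₀ := (⟨fun z => z + 0, by fun_prop⟩ : C(ℂ, ℂ))) tendsto_const_nhds
    ((hT.tendsto 0).comp ha)
    (fun k => measurePreserving_add_right volume (a k)) (measurePreserving_add_right volume 0)
    (by simp)
  rw [tendsto_iff_edist_tendsto_0] at h
  refine h.congr fun k => ?_
  rw [Lp.edist_def]
  refine eLpNorm_congr_ae ?_
  have h1 := Lp.coeFn_compMeasurePreserving (hf.toLp f)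
    (measurePreserving_add_right (volume : Measure ℂ) (a k))
  have h2 := Lp.coeFn_compMeasurePreserving (hf.toLp f)
    (measurePreserving_add_right (volume : Measure ℂ) 0)
  have h3 := (measurePreserving_add_right (volume : Measure ℂ) (a k)).quasiMeasurePreserving.ae
    hf.coeFn_toLp
  have h4 := (measurePreserving_add_right (volume : Measure ℂ) 0).quasiMeasurePreserving.ae
    hf.coeFn_toLp
  filter_upwards [h1, h2, h3, h4] with z h1 h2 h3 h4
  rw [Pi.sub_apply]
  erw [h1, h2]
  rw [Function.comp_apply, Function.comp_apply, h3, h4, add_zero]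

/-- A function that is smooth on an open set agrees on a given compact subset with a function that
is smooth everywhere. -/
theorem ContDiffOn.exists_contDiff_eqOn {K A : Set ℂ} (hK : IsOpen K) (hA : IsCompact A)
    (hAK : A ⊆ K) {u : ℂ → ℝ} (hu : ContDiffOn ℝ ∞ u K) :
    ∃ U : ℂ → ℝ, ContDiff ℝ ∞ U ∧ EqOn U u A := by
  obtain ⟨L, hL, hAL, hLK⟩ := exists_compact_between hA hK hAK
  obtain ⟨χ, hχ1, hχ0, -⟩ := exists_contMDiffMap_one_nhds_of_subset_interior (n := (⊤ : ℕ∞)) 𝓘(ℝ, ℂ)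
    hA.isClosed hAL
  refine ⟨fun z => χ z * u z, ?_, fun z hz => ?_⟩
  · rw [contDiff_iff_contDiffAt]
    intro z
    by_cases hz : z ∈ L
    · exact χ.contMDiff.contDiff.contDiffAt.mul (hu.contDiffAt (hK.mem_nhds (hLK hz)))
    · refine (contDiffAt_const (c := (0 : ℝ))).congr_of_eventuallyEq ?_
      filter_upwards [hL.isClosed.isOpen_compl.mem_nhds hz] with w hw
      rw [hχ0 w hw, zero_mul]
  · simp only
    rw [hχ1.self_of_nhdsSet z hz, one_mul]

/-- The product of a smooth function supported in an open set `K` and a function smooth on `K` is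
smooth. -/
theorem ContDiffOn.mul_of_tsupport_subset {K : Set ℂ} (hK : IsOpen K) {η u : ℂ → ℝ}
    (hη : ContDiff ℝ ∞ η) (hηK : tsupport η ⊆ K) (hu : ContDiffOn ℝ ∞ u K) :
    ContDiff ℝ ∞ fun z => η z * u z := by
  rw [contDiff_iff_contDiffAt]
  intro z
  by_cases hz : z ∈ tsupport η
  · exact hη.contDiffAt.mul (hu.contDiffAt (hK.mem_nhds (hηK hz)))
  · refine (contDiffAt_const (c := (0 : ℝ))).congr_of_eventuallyEq ?_
    filter_upwards [(isClosed_tsupport η).isOpen_compl.mem_nhds hz] with w hw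
    rw [image_eq_zero_of_notMem_tsupport hw, zero_mul]

/-! ### Energy estimates along vertical segments -/

namespace FlatChart

variable {K : Set ℂ} (C : FlatChart K)

/-- A compact subset of the domain of a chart is contained in a smaller closed rectangle. -/
theorem exists_margin {A : Set ℂ} (hA : IsCompact A) (hAb : A ⊆ C.box) :
    ∃ r' δ', r' < C.r ∧ 0 < δ' ∧ δ' < C.δ ∧
      ∀ x t, C.map (x, t) ∈ A → |x| ≤ r' ∧ |t| ≤ δ' := by
  have hA' : IsCompact (C.map ⁻¹' A) := C.map.isCompact_preimage.2 hA
  rcases (C.map ⁻¹' A).eq_empty_or_nonempty with h0 | h0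
  · refine ⟨0, C.δ / 2, C.r_pos, half_pos C.δ_pos, half_lt_self C.δ_pos, fun x t h => ?_⟩
    have : (x, t) ∈ C.map ⁻¹' A := h
    simp [h0] at this
  · obtain ⟨q, hq, hqm⟩ := hA'.exists_isMaxOn h0 (f := fun q : ℝ × ℝ => |q.1|)
      (by fun_prop : Continuous fun q : ℝ × ℝ => |q.1|).continuousOn
    obtain ⟨p, hp, hpm⟩ := hA'.exists_isMaxOn h0 (f := fun q : ℝ × ℝ => |q.2|)
      (by fun_prop : Continuous fun q : ℝ × ℝ => |q.2|).continuousOn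
    have hq' : C.map (q.1, q.2) ∈ C.box := hAb hq
    have hp' : C.map (p.1, p.2) ∈ C.box := hAb hp
    rw [C.mem_box_iff] at hq' hp'
    refine ⟨|q.1|, max |p.2| (C.δ / 2), hq'.1, lt_max_of_lt_right (half_pos C.δ_pos),
      max_lt hp'.2 (half_lt_self C.δ_pos), fun x t h => ⟨hqm (a := (x, t)) h, ?_⟩⟩
    exact le_max_of_le_left (hpm (a := (x, t)) h)

theorem measurableSet_rectPos : MeasurableSet (Ioo (-C.r) C.r ×ˢ Ioo 0 C.δ) :=
  measurableSet_Ioo.prod measurableSet_Ioo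

/-- The part of the chart in `K` contributes at most the integral over `K`. -/
theorem lintegral_chart_le {h : ℂ → ℝ≥0∞} (hh : Measurable h) :
    ∫⁻ x in Ioo (-C.r) C.r, ∫⁻ t in Ioo 0 C.δ, h (C.map (x, t)) ≤ ∫⁻ z in K, h z := by
  have hm : Measurable fun q => h (C.map q) := hh.comp C.map.continuous.measurable
  have h1 : ∫⁻ x in Ioo (-C.r) C.r, ∫⁻ t in Ioo 0 C.δ, h (C.map (x, t)) =
      ∫⁻ q in Ioo (-C.r) C.r ×ˢ Ioo 0 C.δ, h (C.map q) := by
    rw [Measure.volume_eq_prod, ← Measure.prod_restrict, lintegral_prod _ hm.aemeasurable]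
  have h2 : Ioo (-C.r) C.r ×ˢ Ioo 0 C.δ ⊆ C.map ⁻¹' (C.map '' (Ioo (-C.r) C.r ×ˢ Ioo 0 C.δ)) :=
    subset_preimage_image _ _
  rw [h1]
  refine (lintegral_mono_set h2).trans ?_
  rw [C.measurePreserving_map.setLIntegral_comp_preimage_emb C.map.measurableEmbedding]
  refine lintegral_mono_set ?_
  rintro _ ⟨⟨x, t⟩, ⟨hx, ht⟩, rfl⟩
  exact (C.mem_iff (abs_lt.2 hx) (abs_lt.2 ⟨by linarith [ht.1, C.δ_pos], ht.2⟩)).2 ht.1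

/-- The derivative in the direction of the second coordinate of a chart. -/
noncomputable def vert (u : ℂ → ℝ) (z : ℂ) : ℝ := fderiv ℝ u z (C.c * Complex.I)

theorem measurable_vert (u : ℂ → ℝ) : Measurable (C.vert u) := measurable_fderiv_apply_const ℝ u _

theorem measurable_vert_map (u : ℂ → ℝ) : Measurable fun q : ℝ × ℝ => C.vert u (C.map q) :=
  (C.measurable_vert u).comp C.map.continuous.measurable

variable {u : ℂ → ℝ}

theorem mem_of_Ioo {x t : ℝ} (hx : |x| < C.r) (ht : t ∈ Ioo 0 C.δ) : C.map (x, t) ∈ K :=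
  (C.mem_iff hx (abs_lt.2 ⟨by linarith [ht.1, C.δ_pos], ht.2⟩)).2 ht.1

theorem continuousOn_vert (hK : IsOpen K) (hu : ContDiffOn ℝ ∞ u K) {x : ℝ} (hx : |x| < C.r) :
    ContinuousOn (fun s => C.vert u (C.map (x, s))) (Ioo 0 C.δ) := by
  have h1 : ContinuousOn (fun z => C.vert u z) K :=
    (hu.continuousOn_fderiv_of_isOpen hK (by simp)).clm_apply continuousOn_const
  refine h1.comp ?_ fun s hs => C.mem_of_Ioo hx hs
  exact (C.map.continuous.comp (by fun_prop : Continuous fun s : ℝ => (x, s))).continuousOn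

theorem integral_vert (hK : IsOpen K) (hu : ContDiffOn ℝ ∞ u K) {x t t' : ℝ} (hx : |x| < C.r)
    (ht : 0 < t) (htt : t ≤ t') (ht' : t' < C.δ) :
    ∫ s in t..t', C.vert u (C.map (x, s)) = u (C.map (x, t')) - u (C.map (x, t)) := by
  have hsub : uIcc t t' ⊆ Ioo 0 C.δ := by
    rw [uIcc_of_le htt]
    exact fun s hs => ⟨ht.trans_le hs.1, hs.2.trans_lt ht'⟩
  refine intervalIntegral.integral_eq_sub_of_hasDerivAt
    (f := fun s => u (C.map (x, s))) (fun s hs => ?_)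
    ((C.continuousOn_vert hK hu hx).mono hsub).intervalIntegrable
  have hd : DifferentiableAt ℝ u (C.map (x, s)) :=
    (hu.contDiffAt (hK.mem_nhds (C.mem_of_Ioo hx (hsub hs)))).differentiableAt (by simp)
  exact hd.hasFDerivAt.comp_hasDerivAt s (C.hasDerivAt_map_snd x s)

/-- The energy of `u` on a vertical segment of a chart. -/
noncomputable def energy (u : ℂ → ℝ) (x : ℝ) : ℝ≥0∞ :=
  ∫⁻ t in Ioo 0 C.δ, ‖C.vert u (C.map (x, t))‖ₑ ^ 2

theorem measurable_energy (u : ℂ → ℝ) : Measurable (C.energy u) :=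
  Measurable.lintegral_prod_right' (f := fun q : ℝ × ℝ => ‖C.vert u (C.map q)‖ₑ ^ 2)
    ((C.measurable_vert_map u).enorm.pow_const 2)

theorem lintegral_energy_le (u : ℂ → ℝ) :
    ∫⁻ x in Ioo (-C.r) C.r, C.energy u x ≤ ∫⁻ z in K, ‖C.vert u z‖ₑ ^ 2 :=
  C.lintegral_chart_le (h := fun z => ‖C.vert u z‖ₑ ^ 2) ((C.measurable_vert u).enorm.pow_const 2)

theorem sq_enorm_setIntegral_le (u : ℂ → ℝ) (x : ℝ) {A : Set ℝ} (hA : A ⊆ Ioo 0 C.δ) :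
    ‖∫ s in A, C.vert u (C.map (x, s))‖ₑ ^ 2 ≤ volume A * C.energy u x := by
  have hm : Measurable fun s => ‖C.vert u (C.map (x, s))‖ₑ :=
    ((C.measurable_vert_map u).comp measurable_prodMk_left).enorm
  refine (pow_le_pow_left' (enorm_integral_le_lintegral_enorm _) 2).trans ?_
  refine (sq_setLIntegral_le A hm).trans ?_
  gcongr
  exact lintegral_mono_set hA

theorem integrableOn_vert (u : ℂ → ℝ) {x : ℝ} (h : C.energy u x < ⊤) :
    IntegrableOn (fun s => C.vert u (C.map (x, s))) (Ioo 0 C.δ) := by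
  have hm : Measurable fun s => C.vert u (C.map (x, s)) :=
    (C.measurable_vert_map u).comp measurable_prodMk_left
  exact ((memLp_two_iff_lintegral hm.aestronglyMeasurable).2 h).integrable (by norm_num)

end FlatChart

theorem ENNReal.add_sq_le_four_mul (a b : ℝ≥0∞) : (a + b) ^ 2 ≤ 4 * (a ^ 2 + b ^ 2) := by
  have h : a + b ≤ 2 * max a b := by
    rw [two_mul]; exact add_le_add (le_max_left _ _) (le_max_right _ _)
  refine (pow_le_pow_left' h 2).trans ?_
  rw [mul_pow]
  norm_num
  gcongr
  rcases le_total a b with h | h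
  · rw [max_eq_right h]; exact le_add_self
  · rw [max_eq_left h]; exact le_self_add

theorem fderiv_apply_eq (u : ℂ → ℝ) (z e : ℂ) :
    fderiv ℝ u z e = e.re * pdOne u z + e.im * pdTwo u z := by
  conv_lhs => rw [← Complex.re_add_im e]
  rw [_root_.map_add, pdOne, pdTwo, ← Complex.real_smul, map_smul, smul_eq_mul,
    show (e.re : ℂ) = e.re • (1 : ℂ) by simp, map_smul, smul_eq_mul]

theorem memLp_fderiv_apply {u : ℂ → ℝ} {μ : Measure ℂ} (h1 : MemLp (pdOne u) 2 μ)
    (h2 : MemLp (pdTwo u) 2 μ) (e : ℂ) : MemLp (fun z => fderiv ℝ u z e) 2 μ := by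
  simp_rw [fderiv_apply_eq]
  exact (h1.const_mul _).add (h2.const_mul _)

theorem HasCompactSupport.exists_norm_le {f : ℂ → ℝ} (hc : HasCompactSupport f)
    (hf : Continuous f) : ∃ B : ℝ≥0, 0 < B ∧ ∀ z, ‖f z‖ ≤ B := by
  obtain ⟨b, hb⟩ := hf.bounded_above_of_compact_support hc
  refine ⟨(max b 1).toNNReal, by simp, fun z => (hb z).trans ?_⟩
  exact (le_max_left _ _).trans (Real.le_coe_toNNReal _)

namespace FlatChart

variable {K : Set ℂ} (C : FlatChart K)

theorem lintegral_le_chart {h : ℂ → ℝ≥0∞} (hK : IsOpen K)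
    (h0 : ∀ z ∉ C.box, h z = 0) :
    ∫⁻ z in K, h z ≤ ∫⁻ x in Ioo (-C.r) C.r, ∫⁻ t in Ioo 0 C.δ, h (C.map (x, t)) := by
  have h1 : ∫⁻ z in K, h z ≤ ∫⁻ z in C.map '' (Ioo (-C.r) C.r ×ˢ Ioo 0 C.δ), h z := by
    rw [← lintegral_indicator hK.measurableSet, ← lintegral_indicator
      (C.map.measurableEmbedding.measurableSet_image.2 C.measurableSet_rectPos)]
    refine lintegral_mono fun z => ?_
    by_cases hb : z ∈ C.box
    · by_cases hz : z ∈ K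
      · obtain ⟨⟨x, t⟩, ⟨hx, ht⟩, rfl⟩ := hb
        have : C.map (x, t) ∈ C.map '' (Ioo (-C.r) C.r ×ˢ Ioo 0 C.δ) :=
          ⟨(x, t), ⟨hx, (C.mem_iff (abs_lt.2 hx) (abs_lt.2 ht)).1 hz, ht.2⟩, rfl⟩
        rw [indicator_of_mem hz, indicator_of_mem this]
      · rw [indicator_of_notMem hz]
        exact zero_le
    · simp [indicator, h0 z hb]
  refine h1.trans ?_
  rw [← C.measurePreserving_map.setLIntegral_comp_preimage_emb C.map.measurableEmbedding,
    preimage_image_eq _ C.map.injective, Measure.volume_eq_prod, ← Measure.prod_restrict]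
  exact lintegral_prod_le _

variable {u η : ℂ → ℝ}

/-- A function with square integrable gradient is square integrable near the boundary. -/
theorem memLp_mul (hK : IsOpen K) (hu : ContDiffOn ℝ ∞ u K)
    (hE : ∫⁻ z in K, ‖C.vert u z‖ₑ ^ 2 < ⊤) (hη : Continuous η) (hc : HasCompactSupport η)
    (hb : tsupport η ⊆ C.box) : MemLp (fun z => η z * u z) 2 (volume.restrict K) := by
  have hm : AEStronglyMeasurable (fun z => η z * u z) (volume.restrict K) :=
    (hη.continuousOn.mul hu.continuousOn).aestronglyMeasurable hK.measurableSet
  rw [memLp_two_iff_lintegral hm]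
  obtain ⟨r', δ', hr', hδ0, hδ', hA⟩ := C.exists_margin hc hb
  obtain ⟨B, -, hB⟩ := hc.exists_norm_le hη
  have hBe : ∀ z, ‖η z‖ₑ ≤ B := fun z => by
    rw [enorm_le_coe]; exact hB z
  have h0 : ∀ z ∉ tsupport η, η z = 0 := fun z hz => image_eq_zero_of_notMem_tsupport hz
  -- The level `t = δ'` over `|x| ≤ r'` is a compact curve inside `K`, where `u` is bounded; it
  -- serves as the starting level for integration towards the boundary.
  obtain ⟨b, hb'⟩ : ∃ b : ℝ≥0, ∀ x : ℝ, |x| ≤ r' → ‖u (C.map (x, δ'))‖ₑ ≤ b := by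
    have hcont : ContinuousOn (fun x => u (C.map (x, δ'))) (Icc (-r') r') := by
      refine hu.continuousOn.comp (C.lipschitzWith_map_fst δ').continuous.continuousOn fun x hx => ?_
      exact C.mem_of_Ioo ((abs_le.2 hx).trans_lt hr') ⟨hδ0, hδ'⟩
    obtain ⟨b, hb⟩ := isCompact_Icc.exists_bound_of_continuousOn hcont
    refine ⟨b.toNNReal, fun x hx => ?_⟩
    rw [enorm_le_coe]
    exact (hb x (abs_le.1 hx)).trans (Real.le_coe_toNNReal _)
  -- On the support of `η`, `u` at height `t` is its value at level `δ'` minus the integral of the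
  -- vertical derivative, which Cauchy–Schwarz bounds by the energy.
  have key : ∀ x ∈ Ioo (-C.r) C.r, ∀ t ∈ Ioo 0 C.δ, ‖η (C.map (x, t)) * u (C.map (x, t))‖ₑ ^ 2 ≤
      (B : ℝ≥0∞) ^ 2 * (4 * ((b : ℝ≥0∞) ^ 2 + ENNReal.ofReal C.δ * C.energy u x)) := by
    intro x hx t ht
    by_cases hz : C.map (x, t) ∈ tsupport η
    · obtain ⟨hx', ht'⟩ := hA x t hz
      have ht'' : t ≤ δ' := (le_abs_self t).trans ht'
      have h1 := C.integral_vert hK hu (abs_lt.2 hx) ht.1 ht'' hδ'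
      rw [intervalIntegral.integral_of_le ht''] at h1
      have h2 : u (C.map (x, t)) = u (C.map (x, δ')) -
          ∫ s in Ioc t δ', C.vert u (C.map (x, s)) := by rw [h1]; ring
      have hsub : Ioc t δ' ⊆ Ioo 0 C.δ := fun s hs => ⟨ht.1.trans hs.1, hs.2.trans_lt hδ'⟩
      rw [enorm_mul, mul_pow]
      gcongr
      · exact hBe _
      · rw [h2]
        refine (pow_le_pow_left' (enorm_sub_le) 2).trans ((ENNReal.add_sq_le_four_mul _ _).trans ?_)
        gcongr
        · exact hb' x hx'
        · refine (C.sq_enorm_setIntegral_le u x hsub).trans ?_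
          gcongr
          refine (measure_mono hsub).trans ?_
          simp
    · rw [h0 _ hz]; simp
  refine (C.lintegral_le_chart hK fun z hz => ?_).trans_lt ?_
  · rw [h0 z fun h => hz (hb h)]; simp
  have h3 : ∫⁻ x in Ioo (-C.r) C.r, ∫⁻ t in Ioo 0 C.δ, ‖η (C.map (x, t)) * u (C.map (x, t))‖ₑ ^ 2 ≤
      ∫⁻ x in Ioo (-C.r) C.r, ENNReal.ofReal C.δ * ((B : ℝ≥0∞) ^ 2 *
        (4 * ((b : ℝ≥0∞) ^ 2 + ENNReal.ofReal C.δ * C.energy u x))) := by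
    refine setLIntegral_mono' measurableSet_Ioo fun x hx => ?_
    refine (setLIntegral_mono' measurableSet_Ioo (key x hx)).trans ?_
    rw [setLIntegral_const, mul_comm]
    simp
  refine h3.trans_lt ?_
  have hfin : ∫⁻ x in Ioo (-C.r) C.r, C.energy u x < ⊤ := (C.lintegral_energy_le u).trans_lt hE
  rw [lintegral_const_mul' _ _ (by simp), lintegral_const_mul' _ _ (by simp),
    lintegral_const_mul' _ _ (by simp), lintegral_add_left measurable_const,
    lintegral_const_mul' _ _ (by simp)]
  refine ENNReal.mul_lt_top (by simp) (ENNReal.mul_lt_top (by simp) (ENNReal.mul_lt_top (by simp)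
    (ENNReal.add_lt_top.2 ⟨?_, ENNReal.mul_lt_top (by simp) hfin⟩)))
  rw [setLIntegral_const]
  exact ENNReal.mul_lt_top (by simp) (by simp)

end FlatChart

namespace CurvilinearPolygon

variable {P : CurvilinearPolygon} {u : ℂ → ℝ}

/-- In a curvilinear polygon a function with square integrable gradient is square integrable. -/
theorem memLp_of_memLp_gradient (hu : ContDiffOn ℝ ∞ u P.carrier)
    (h1 : MemLp (pdOne u) 2 (volume.restrict P.carrier))
    (h2 : MemLp (pdTwo u) 2 (volume.restrict P.carrier)) :
    MemLp u 2 (volume.restrict P.carrier) := by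
  obtain ⟨ι, _, η, hη, hηc, hηs, hη1⟩ := P.exists_partitionOfUnity
  have h : ∀ j, MemLp (fun z => η j z * u z) 2 (volume.restrict P.carrier) := by
    intro j
    rcases hηs j with h | ⟨C, h⟩
    · have hs := hu.mul_of_tsupport_subset P.isOpen (hη j) h
      exact (hs.continuous.memLp_of_hasCompactSupport (hηc j).mul_right).restrict _
    · refine C.memLp_mul P.isOpen hu ?_ (hη j).continuous (hηc j) h
      have hv := memLp_fderiv_apply h1 h2 (C.c * Complex.I)
      exact (memLp_two_iff_lintegral hv.1).1 hv
  have hsum : MemLp (fun z => ∑ j, η j z * u z) 2 (volume.restrict P.carrier) :=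
    memLp_finsetSum _ fun j _ => h j
  refine hsum.ae_eq ?_
  filter_upwards [ae_restrict_mem P.isOpen.measurableSet] with z hz
  rw [← Finset.sum_mul, hη1 z (subset_closure hz), one_mul]

end CurvilinearPolygon

/-! ### Traces and smooth approximation -/

theorem ENNReal.tendsto_zero_of_sq {f : ℕ → ℝ≥0∞} (h : Tendsto (fun k => f k ^ 2) atTop (𝓝 0)) :
    Tendsto f atTop (𝓝 0) := by
  have hr := ((ENNReal.continuous_rpow_const (y := 1 / 2)).tendsto (0 : ℝ≥0∞)).comp h
  rw [ENNReal.zero_rpow_of_pos (by norm_num)] at hr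
  refine hr.congr fun k => ?_
  rw [Function.comp_apply, ← ENNReal.rpow_natCast, ← ENNReal.rpow_mul]
  norm_num

namespace FlatChart

variable {K : Set ℂ} (C : FlatChart K) {u η : ℂ → ℝ}

/-- The inward translation direction of a chart. -/
noncomputable def inward : ℂ := C.c * Complex.I

/-- Near the support of a function supported in the domain of a chart, small inward translations
map the closure of `K` into `K`. -/
theorem add_inward_mem (hK : IsOpen K) {r' δ' ε : ℝ} {A : Set ℂ} (hr' : r' < C.r) (hδ' : δ' < C.δ)
    (hA : ∀ x t, C.map (x, t) ∈ A → |x| ≤ r' ∧ |t| ≤ δ') (hε : 0 < ε) (hε' : ε < C.δ - δ') {z : ℂ}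
    (hz : z ∈ A) (hzK : z ∈ closure K) : z + ε * C.inward ∈ K := by
  obtain ⟨x, t, rfl⟩ := C.exists_map_eq z
  obtain ⟨hx, ht⟩ := hA x t hz
  have h0 := (C.mem_closure hK (hx.trans_lt hr') (ht.trans_lt hδ')).1 hzK
  rw [inward, ← C.map_add]
  rw [abs_of_nonneg h0] at ht
  exact C.mem_of_Ioo (hx.trans_lt hr') ⟨by linarith, by linarith⟩

/-- The boundary values of `η u`, obtained by integrating the derivative of `u` along the inward
direction from a level inside `K`. -/
noncomputable def boundaryValue (δ' : ℝ) (u η : ℂ → ℝ) (z : ℂ) : ℝ :=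
  η z * (u (z + δ' * C.inward) - ∫ t in Ioc 0 δ', C.vert u (z + t * C.inward))

/-- The difference is `η` times the integral of the vertical derivative over `(0, ε]`;
Cauchy–Schwarz supplies the factor `ε` that makes the translates converge on the boundary. -/
theorem sq_enorm_translate_sub_boundaryValue_le (hK : IsOpen K) (hu : ContDiffOn ℝ ∞ u K)
    {B : ℝ≥0} (hB0 : 0 < B) (hB : ∀ z, ‖η z‖ ≤ B) {x ε δ' : ℝ} (hx : |x| < C.r) (hε : 0 < ε)
    (hεδ : ε ≤ δ') (hδ' : δ' < C.δ) :
    ‖η (C.map (x, 0)) * u (C.map (x, 0) + ε * C.inward) -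
      C.boundaryValue δ' u η (C.map (x, 0))‖ₑ ^ 2 ≤
      (B : ℝ≥0∞) ^ 2 * (ENNReal.ofReal ε * C.energy u x) := by
  -- On a segment of infinite energy the right side is `⊤`, because `ε` and `B` are positive.
  rcases eq_or_ne (C.energy u x) ⊤ with htop | htop
  · rw [htop, ENNReal.mul_top (by simpa using hε), ENNReal.mul_top (by simpa using hB0.ne')]
    exact le_top
  have hmap : ∀ t : ℝ, C.map (x, 0) + t * C.inward = C.map (x, t) := fun t => by
    rw [inward, ← C.map_add, zero_add]
  have hsub : Ioc 0 ε ⊆ Ioo 0 C.δ := fun s hs => ⟨hs.1, by linarith [hs.2]⟩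
  have hsub' : Ioc 0 δ' ⊆ Ioo 0 C.δ := fun s hs => ⟨hs.1, by linarith [hs.2]⟩
  have hint := C.integrableOn_vert u (lt_top_iff_ne_top.2 htop)
  have h1 := C.integral_vert hK hu hx hε hεδ hδ'
  rw [intervalIntegral.integral_of_le hεδ] at h1
  have h2 : ∫ t in Ioc 0 δ', C.vert u (C.map (x, t)) =
      (∫ t in Ioc 0 ε, C.vert u (C.map (x, t))) + ∫ t in Ioc ε δ', C.vert u (C.map (x, t)) := by
    rw [← Ioc_union_Ioc_eq_Ioc hε.le hεδ]
    refine setIntegral_union (Ioc_disjoint_Ioc_of_le le_rfl) measurableSet_Ioc (hint.mono_set hsub)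
      (hint.mono_set fun s hs => hsub' ⟨hε.trans hs.1, hs.2⟩)
  have h3 : η (C.map (x, 0)) * u (C.map (x, 0) + ε * C.inward) -
      C.boundaryValue δ' u η (C.map (x, 0)) =
      η (C.map (x, 0)) * ∫ t in Ioc 0 ε, C.vert u (C.map (x, t)) := by
    simp only [boundaryValue, hmap]
    rw [h2, h1]
    ring
  rw [h3, enorm_mul, mul_pow]
  gcongr
  · rw [enorm_le_coe]; exact hB _
  · refine (C.sq_enorm_setIntegral_le u x hsub).trans ?_
    gcongr
    simp

end FlatChart

namespace CurvilinearPolygon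

variable {P : CurvilinearPolygon} {u η : ℂ → ℝ}

/-- `K` is open, so agreement on `K` extends to the derivatives there; values of `u` outside `K` do
not enter. -/
theorem HasTrace.congr {u u' g : ℂ → ℝ} (h : P.HasTrace u g)
    (huu' : ∀ z ∈ P.carrier, u z = u' z) : P.HasTrace u' g := by
  have hev : ∀ z ∈ P.carrier, u =ᶠ[𝓝 z] u' := fun z hz => by
    filter_upwards [P.isOpen.mem_nhds hz] with w hw using huu' w hw
  have h1 : ∀ z ∈ P.carrier, pdOne u z = pdOne u' z := fun z hz => by
    rw [pdOne, (hev z hz).fderiv_eq, pdOne]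
  have h2 : ∀ z ∈ P.carrier, pdTwo u z = pdTwo u' z := fun z hz => by
    rw [pdTwo, (hev z hz).fderiv_eq, pdTwo]
  obtain ⟨hg, w, hw, t0, t1, t2, t3⟩ := h
  refine ⟨hg, w, hw, t0.congr fun k => ?_, t1.congr fun k => ?_, t2.congr fun k => ?_, t3⟩
  all_goals
    refine eLpNorm_congr_ae ?_
    filter_upwards [ae_restrict_mem P.isOpen.measurableSet] with z hz
  · rw [huu' z hz]
  · rw [h1 z hz]
  · rw [h2 z hz]

theorem measurable_pdOne (u : ℂ → ℝ) : Measurable (pdOne u) := measurable_fderiv_apply_const ℝ u _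

theorem measurable_pdTwo (u : ℂ → ℝ) : Measurable (pdTwo u) := measurable_fderiv_apply_const ℝ u _

theorem tendsto_eLpNorm_sum {α ι : Type*} [MeasurableSpace α] {μ : Measure α} [Fintype ι]
    {f : ι → ℕ → α → ℝ} {g : ι → α → ℝ} {F : ℕ → α → ℝ} {G : α → ℝ}
    (hf : ∀ j k, AEStronglyMeasurable (f j k) μ) (hg : ∀ j, AEStronglyMeasurable (g j) μ)
    (h : ∀ j, Tendsto (fun k => eLpNorm (fun x => f j k x - g j x) 2 μ) atTop (𝓝 0))
    (hF : ∀ k, ∀ᵐ x ∂μ, F k x = ∑ j, f j k x) (hG : ∀ᵐ x ∂μ, G x = ∑ j, g j x) :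
    Tendsto (fun k => eLpNorm (fun x => F k x - G x) 2 μ) atTop (𝓝 0) := by
  have hsum := tendsto_finsetSum Finset.univ fun j _ => h j
  rw [Finset.sum_const_zero] at hsum
  refine tendsto_of_tendsto_of_tendsto_of_le_of_le tendsto_const_nhds hsum (fun _ => zero_le)
    fun k => ?_
  refine le_trans (le_of_eq ?_) (eLpNorm_sum_le (f := fun j x => f j k x - g j x)
    (fun j _ => (hf j k).sub (hg j)) one_le_two)
  refine eLpNorm_congr_ae ?_
  filter_upwards [hF k, hG] with x h1 h2
  simp only [h1, h2, Finset.sum_apply, Finset.sum_sub_distrib]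

theorem HasTrace.sum {ι : Type*} [Fintype ι] {u g : ι → ℂ → ℝ}
    (hd : ∀ j, ∀ z ∈ P.carrier, DifferentiableAt ℝ (u j) z) (h : ∀ j, P.HasTrace (u j) (g j)) :
    P.HasTrace (fun z => ∑ j, u j z) (fun z => ∑ j, g j z) := by
  choose hg w hw t0 t1 t2 t3 using h
  have hum : ∀ j, AEStronglyMeasurable (u j) (volume.restrict P.carrier) := fun j =>
    ContinuousOn.aestronglyMeasurable
      (fun z hz => (hd j z hz).continuousAt.continuousWithinAt) P.isOpen.measurableSet
  have hfd : ∀ e : ℂ, ∀ z ∈ P.carrier, fderiv ℝ (fun z => ∑ j, u j z) z e =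
      ∑ j, fderiv ℝ (u j) z e := fun e z hz => by
    rw [fderiv_fun_sum fun j _ => hd j z hz, _root_.sum_apply]
  have hfw : ∀ k, ∀ e : ℂ, ∀ z, fderiv ℝ (fun z => ∑ j, w j k z) z e =
      ∑ j, fderiv ℝ (w j k) z e := fun k e z => by
    rw [fderiv_fun_sum fun j _ => (hw j k).differentiable (by simp) z, _root_.sum_apply]
  refine ⟨fun i => memLp_finsetSum _ fun j _ => hg j i, fun k z => ∑ j, w j k z,
    fun k => ContDiff.sum fun j _ => hw j k, ?_, ?_, ?_, fun i => ?_⟩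
  · exact tendsto_eLpNorm_sum (fun j k => (hw j k).continuous.aestronglyMeasurable) hum t0
      (fun k => Eventually.of_forall fun _ => rfl) (Eventually.of_forall fun _ => rfl)
  · refine tendsto_eLpNorm_sum (fun j k => (measurable_pdOne _).aestronglyMeasurable)
      (fun j => (measurable_pdOne _).aestronglyMeasurable) t1
      (fun k => Eventually.of_forall fun z => hfw k 1 z) ?_
    filter_upwards [ae_restrict_mem P.isOpen.measurableSet] with z hz using hfd 1 z hz
  · refine tendsto_eLpNorm_sum (fun j k => (measurable_pdTwo _).aestronglyMeasurable)
      (fun j => (measurable_pdTwo _).aestronglyMeasurable) t2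
      (fun k => Eventually.of_forall fun z => hfw k Complex.I z) ?_
    filter_upwards [ae_restrict_mem P.isOpen.measurableSet] with z hz using hfd Complex.I z hz
  · exact tendsto_eLpNorm_sum
      (fun j k => ((hw j k).continuous.comp (continuous_edge i)).aestronglyMeasurable)
      (fun j => (hg j i).1) (fun j => t3 j i)
      (fun k => Eventually.of_forall fun _ => rfl) (Eventually.of_forall fun _ => rfl)

theorem hasTrace_of_contDiff (hu : ContDiff ℝ ∞ u) : P.HasTrace u u := by
  refine ⟨fun i => ?_, fun _ => u, fun _ => hu, by simp, by simp, by simp, by simp⟩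
  have hc : Continuous fun s => u (P.edge i s) := hu.continuous.comp (continuous_edge i)
  obtain ⟨b, hb⟩ := isCompact_Icc.exists_bound_of_continuousOn (hc.continuousOn (s := Icc 0 (P.len i)))
  exact MemLp.of_bound hc.aestronglyMeasurable b
    ((ae_restrict_mem measurableSet_Icc).mono hb)

section Local

variable {C : FlatChart P.carrier}

/-- The product rule for the difference between a translate and the function itself. -/
theorem fderiv_translate_sub (hK : IsOpen P.carrier) (hu : ContDiffOn ℝ ∞ u P.carrier)
    (hη : ContDiff ℝ ∞ η) {W : ℂ → ℝ} {a : ℂ} (ha : ∀ z ∈ tsupport η, z ∈ P.carrier →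
      z + a ∈ P.carrier) (hW : ∀ z ∈ P.carrier, W z = η z * u (z + a)) {z : ℂ}
    (hz : z ∈ P.carrier) (e : ℂ) :
    fderiv ℝ W z e - fderiv ℝ (fun z => η z * u z) z e =
      fderiv ℝ η z e * (P.carrier.indicator u (z + a) - P.carrier.indicator u z) +
      η z * (P.carrier.indicator (fun z => fderiv ℝ u z e) (z + a) -
        P.carrier.indicator (fun z => fderiv ℝ u z e) z) := by
  have hWev : W =ᶠ[𝓝 z] fun z => η z * u (z + a) := by
    filter_upwards [hK.mem_nhds hz] with w hw using hW w hw
  have hηd : DifferentiableAt ℝ η z := hη.differentiable (by simp) z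
  have hdu : ∀ z ∈ P.carrier, DifferentiableAt ℝ u z := fun z hz =>
    (hu.contDiffAt (hK.mem_nhds hz)).differentiableAt (by simp)
  rw [hWev.fderiv_eq]
  by_cases hs : z ∈ tsupport η
  · have hza := ha z hs hz
    have hd : DifferentiableAt ℝ (fun z => u (z + a)) z :=
      (hdu _ hza).comp z (by fun_prop : DifferentiableAt ℝ (fun z : ℂ => z + a) z)
    rw [fderiv_fun_mul hηd hd, fderiv_fun_mul hηd (hdu z hz), fderiv_comp_add_right,
      indicator_of_mem hza, indicator_of_mem hz, indicator_of_mem hza, indicator_of_mem hz]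
    simp only [_root_.add_apply, _root_.smul_apply, smul_eq_mul]
    ring
  · have hev : η =ᶠ[𝓝 z] fun _ => 0 := by
      filter_upwards [(isClosed_tsupport η).isOpen_compl.mem_nhds hs] with w hw
      exact image_eq_zero_of_notMem_tsupport hw
    have h1 : (fun z => η z * u (z + a)) =ᶠ[𝓝 z] fun _ => 0 := by
      filter_upwards [hev] with w hw; rw [hw, zero_mul]
    have h2 : (fun z => η z * u z) =ᶠ[𝓝 z] fun _ => 0 := by
      filter_upwards [hev] with w hw; rw [hw, zero_mul]
    rw [h1.fderiv_eq, h2.fderiv_eq, hev.fderiv_eq, hev.self_of_nhds]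
    simp

/-- Extended by zero, `f` is square integrable on the plane, where translation is continuous in
`L²`; the bounded factor `η` costs a constant. -/
theorem tendsto_eLpNorm_mul_translate {B : ℝ≥0} (hB : ∀ z, ‖η z‖ ≤ B)
    {f : ℂ → ℝ} (hf : MemLp f 2 (volume.restrict P.carrier)) {a : ℕ → ℂ}
    (ha : Tendsto a atTop (𝓝 0)) :
    Tendsto (fun k => eLpNorm (fun z => η z * (P.carrier.indicator f (z + a k) -
      P.carrier.indicator f z)) 2 (volume.restrict P.carrier)) atTop (𝓝 0) := by
  have h := tendsto_eLpNorm_translate ((memLp_indicator_iff_restrict P.isOpen.measurableSet).2 hf) ha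
  have h' := ENNReal.Tendsto.const_mul (a := (B : ℝ≥0∞)) h (Or.inr (by simp))
  rw [mul_zero] at h'
  refine tendsto_of_tendsto_of_tendsto_of_le_of_le tendsto_const_nhds h' (fun _ => zero_le)
    fun k => ?_
  refine (eLpNorm_mono_measure _ Measure.restrict_le_self).trans ?_
  refine eLpNorm_le_nnreal_smul_eLpNorm_of_ae_le_mul (Eventually.of_forall fun z => ?_) 2
  rw [nnnorm_mul]
  gcongr
  exact hB z

/-- The product of a function with square integrable gradient and a cut-off supported in the domain
of a chart has a trace. -/
theorem exists_hasTrace_mul (hu : ContDiffOn ℝ ∞ u P.carrier)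
    (h0 : MemLp u 2 (volume.restrict P.carrier))
    (h1 : MemLp (pdOne u) 2 (volume.restrict P.carrier))
    (h2 : MemLp (pdTwo u) 2 (volume.restrict P.carrier))
    (hη : ContDiff ℝ ∞ η) (hc : HasCompactSupport η) (hb : tsupport η ⊆ C.box) :
    ∃ g, P.HasTrace (fun z => η z * u z) g := by
  obtain ⟨r', δ', hr', hδ0, hδ', hA⟩ := C.exists_margin hc hb
  obtain ⟨B, hB0, hB⟩ := hc.exists_norm_le hη.continuous
  have hη0 : ∀ z ∉ tsupport η, η z = 0 := fun z hz => image_eq_zero_of_notMem_tsupport hz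
  -- Shifts up to `ε₀` do not pass the level `δ'`, and they keep points of height at most `δ'`
  -- inside the chart.
  let ε₀ : ℝ := min δ' ((C.δ - δ') / 2)
  have hε₀ : 0 < ε₀ := lt_min hδ0 (by linarith)
  let ε : ℕ → ℝ := fun k => ε₀ / (k + 1)
  have hε : ∀ k, 0 < ε k := fun k => by positivity
  have hεle : ∀ k, ε k ≤ ε₀ := fun k =>
    div_le_self hε₀.le (by linarith [(Nat.cast_nonneg k : (0 : ℝ) ≤ k)])
  have hεδ : ∀ k, ε k ≤ δ' := fun k => (hεle k).trans (min_le_left _ _)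
  have hεδ' : ∀ k, ε k < C.δ - δ' := fun k =>
    ((hεle k).trans (min_le_right _ _)).trans_lt (by linarith)
  have hε_lim : Tendsto ε atTop (𝓝 0) := by
    have := (tendsto_const_div_atTop_nhds_zero_nat ε₀).comp (tendsto_add_atTop_nat 1)
    refine this.congr fun k => ?_
    simp [ε]
  have hε_ofReal : Tendsto (fun k => ENNReal.ofReal (ε k)) atTop (𝓝 0) := by
    have := (ENNReal.continuous_ofReal.tendsto 0).comp hε_lim
    rwa [ENNReal.ofReal_zero] at this
  let a : ℕ → ℂ := fun k => ε k * C.inward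
  have ha_lim : Tendsto a atTop (𝓝 0) := by
    have := ((Complex.continuous_ofReal.tendsto 0).comp hε_lim).mul_const C.inward
    simpa using this
  have haK : ∀ k, ∀ z ∈ tsupport η, z ∈ closure P.carrier → z + a k ∈ P.carrier := fun k z hz hzK =>
    C.add_inward_mem P.isOpen hr' hδ' hA (hε k) (hεδ' k) hz hzK
  -- The shift carries the compact set `tsupport η ∩ closure K` into `K`, where `u` agrees with a
  -- globally smooth function. Thus `η u(· + a k)` is smooth up to the boundary.
  have hW : ∀ k, ∃ W : ℂ → ℝ, ContDiff ℝ ∞ W ∧ ∀ z ∈ closure P.carrier, W z = η z * u (z + a k) := by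
    intro k
    have hcomp : IsCompact ((fun z => z + a k) '' (tsupport η ∩ closure P.carrier)) :=
      (hc.isCompact.inter_right isClosed_closure).image (by fun_prop)
    obtain ⟨U, hU, hUu⟩ := hu.exists_contDiff_eqOn P.isOpen hcomp
      (image_subset_iff.2 fun z hz => haK k z hz.1 hz.2)
    refine ⟨fun z => η z * U (z + a k), hη.mul (hU.comp (contDiff_id.add contDiff_const)),
      fun z hz => ?_⟩
    by_cases hs : z ∈ tsupport η
    · simp only
      rw [hUu ⟨z, ⟨hs, hz⟩, rfl⟩]
    · simp only [hη0 z hs, zero_mul]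
  choose W hWs hWeq using hW
  have hpd : ∀ e : ℂ, Tendsto (fun k => eLpNorm (fun z => fderiv ℝ (W k) z e -
      fderiv ℝ (fun z => η z * u z) z e) 2 (volume.restrict P.carrier)) atTop (𝓝 0) := by
    intro e
    obtain ⟨B', -, hB'⟩ := (hc.fderiv_apply ℝ e).exists_norm_le
      (FlatChart.continuous_fderiv_apply (hη.of_le (by simp)) e)
    have t1 := tendsto_eLpNorm_mul_translate (P := P) hB' h0 ha_lim
    have t2 := tendsto_eLpNorm_mul_translate (P := P) hB (memLp_fderiv_apply h1 h2 e) ha_lim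
    have t3 := t1.add t2
    rw [add_zero] at t3
    refine tendsto_of_tendsto_of_tendsto_of_le_of_le tendsto_const_nhds t3 (fun _ => zero_le)
      fun k => ?_
    have hm : ∀ {f : ℂ → ℝ}, MemLp f 2 (volume.restrict P.carrier) → AEStronglyMeasurable
        (fun z => P.carrier.indicator f (z + a k) - P.carrier.indicator f z)
        (volume.restrict P.carrier) := by
      intro f hf
      have hf' := (memLp_indicator_iff_restrict P.isOpen.measurableSet).2 hf
      exact ((hf'.1.comp_quasiMeasurePreserving
        (measurePreserving_add_right volume (a k)).quasiMeasurePreserving).sub hf'.1).restrict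
    refine le_trans (le_of_eq ?_) (eLpNorm_add_le
      ((FlatChart.continuous_fderiv_apply (hη.of_le (by simp)) e).aestronglyMeasurable.mul (hm h0))
      (hη.continuous.aestronglyMeasurable.mul (hm (memLp_fderiv_apply h1 h2 e))) one_le_two)
    refine eLpNorm_congr_ae ?_
    filter_upwards [ae_restrict_mem P.isOpen.measurableSet] with z hz
    exact fderiv_translate_sub P.isOpen hu hη (fun z hs hz => haK k z hs (subset_closure hz))
      (fun z hz => hWeq k z (subset_closure hz)) hz e
  have hE : ∫⁻ z in P.carrier, ‖C.vert u z‖ₑ ^ 2 < ⊤ := by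
    have hv := memLp_fderiv_apply h1 h2 (C.c * Complex.I)
    exact (memLp_two_iff_lintegral hv.1).1 hv
  let g := C.boundaryValue δ' u η
  have hWc : ∀ k i, Continuous fun s => W k (P.edge i s) := fun k i =>
    (hWs k).continuous.comp (continuous_edge i)
  have hg0 : ∀ z ∉ tsupport η, g z = 0 := fun z hz => by
    simp only [g, FlatChart.boundaryValue, hη0 z hz, zero_mul]
  have hout : ∀ k i, ∀ s ∈ Icc 0 (P.len i), P.edge i s ∉ C.box →
      W k (P.edge i s) = 0 ∧ g (P.edge i s) = 0 := fun k i s hs hsb => by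
    have hst : P.edge i s ∉ tsupport η := fun h => hsb (hb h)
    refine ⟨?_, hg0 _ hst⟩
    rw [hWeq k _ (frontier_subset_closure (P.edge_mem_frontier i hs)), hη0 _ hst, zero_mul]
  have hin : ∀ k i, ∀ s ∈ P.paramSet C i, ‖W k (P.edge i s) - g (P.edge i s)‖ₑ ^ 2 ≤
      (B : ℝ≥0∞) ^ 2 * (ENNReal.ofReal (ε k) * C.energy u (P.edgeX C i s)) := fun k i s hs => by
    rw [hWeq k _ (frontier_subset_closure (mem_frontier_of_mem_paramSet hs)), ← map_edgeX hs]
    exact C.sq_enorm_translate_sub_boundaryValue_le P.isOpen hu hB0 hB (abs_edgeX_lt hs) (hε k)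
      (hεδ k) hδ'
  have hfin : ∀ i, ∫⁻ s in P.paramSet C i, C.energy u (P.edgeX C i s) < ⊤ := fun i =>
    (lintegral_paramSet_le _ i).trans_lt (ENNReal.mul_lt_top (by simp)
      ((C.lintegral_energy_le u).trans_lt hE))
  have hedgeX : ∀ i, Measurable (P.edgeX C i) := fun i =>
    (Complex.continuous_re.comp (C.continuous_coord.comp (continuous_edge i))).measurable
  have hIoo : ∀ i, volume.restrict (Icc 0 (P.len i)) = volume.restrict (Ioo 0 (P.len i)) := fun i =>
    Measure.restrict_congr_set Ioo_ae_eq_Icc.symm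
  -- Measurability along the edge comes from pointwise convergence of the continuous functions `W
  -- k`, valid at every interior parameter outside the chart and, inside it, wherever the energy is
  -- finite, hence almost everywhere.
  have hgm : ∀ i, AEStronglyMeasurable (fun s => g (P.edge i s))
      (volume.restrict (Icc 0 (P.len i))) := by
    intro i
    refine aestronglyMeasurable_of_tendsto_ae atTop (f := fun k s => W k (P.edge i s))
      (fun k => (hWc k i).aestronglyMeasurable) ?_
    have hae : ∀ᵐ s ∂volume.restrict (P.paramSet C i), C.energy u (P.edgeX C i s) < ⊤ :=
      ae_lt_top ((C.measurable_energy u).comp (hedgeX i)) (hfin i).ne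
    rw [ae_restrict_iff' (P.isOpen_paramSet C i).measurableSet] at hae
    rw [hIoo, ae_restrict_iff' measurableSet_Ioo]
    filter_upwards [hae] with s hs hsI
    by_cases hsb : P.edge i s ∈ C.box
    · have hsS : s ∈ P.paramSet C i := ⟨hsI, hsb⟩
      rw [tendsto_iff_edist_tendsto_0]
      have hlim : Tendsto (fun k => (B : ℝ≥0∞) ^ 2 *
          (ENNReal.ofReal (ε k) * C.energy u (P.edgeX C i s))) atTop (𝓝 0) := by
        have e2 := ENNReal.Tendsto.mul_const (b := C.energy u (P.edgeX C i s)) hε_ofReal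
          (Or.inr (hs hsS).ne)
        have e3 := ENNReal.Tendsto.const_mul (a := (B : ℝ≥0∞) ^ 2) e2 (Or.inr (by simp))
        simpa using e3
      have hsq : Tendsto (fun k => ‖W k (P.edge i s) - g (P.edge i s)‖ₑ ^ 2) atTop (𝓝 0) :=
        tendsto_of_tendsto_of_tendsto_of_le_of_le tendsto_const_nhds hlim (fun _ => zero_le)
          fun k => hin k i s hsS
      simpa only [edist_eq_enorm_sub] using ENNReal.tendsto_zero_of_sq hsq
    · refine tendsto_const_nhds.congr' (Eventually.of_forall fun k => ?_)
      have := hout k i s ⟨hsI.1.le, hsI.2.le⟩ hsb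
      exact this.2.trans this.1.symm
  have hbd : ∀ k i, ∫⁻ s in Icc 0 (P.len i), ‖W k (P.edge i s) - g (P.edge i s)‖ₑ ^ 2 ≤
      (B : ℝ≥0∞) ^ 2 * (ENNReal.ofReal (ε k) *
        ∫⁻ s in P.paramSet C i, C.energy u (P.edgeX C i s)) := by
    intro k i
    rw [← lintegral_const_mul' _ _ (by simp), ← lintegral_const_mul' _ _ (by simp), hIoo,
      ← lintegral_indicator measurableSet_Ioo,
      ← lintegral_indicator (P.isOpen_paramSet C i).measurableSet]
    refine lintegral_mono fun s => ?_
    by_cases hsI : s ∈ Ioo 0 (P.len i)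
    · by_cases hsb : P.edge i s ∈ C.box
      · have hsS : s ∈ P.paramSet C i := ⟨hsI, hsb⟩
        rw [indicator_of_mem hsI, indicator_of_mem hsS]
        exact hin k i s hsS
      · have := hout k i s ⟨hsI.1.le, hsI.2.le⟩ hsb
        simp [indicator, this.1, this.2]
    · simp [indicator, hsI]
  have hlim : ∀ i, Tendsto (fun k => eLpNorm (fun s => W k (P.edge i s) - g (P.edge i s)) 2
      (volume.restrict (Icc 0 (P.len i)))) atTop (𝓝 0) := by
    intro i
    have e2 := ENNReal.Tendsto.mul_const
      (b := ∫⁻ s in P.paramSet C i, C.energy u (P.edgeX C i s)) hε_ofReal (Or.inr (hfin i).ne)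
    have e3 := ENNReal.Tendsto.const_mul (a := (B : ℝ≥0∞) ^ 2) e2 (Or.inr (by simp))
    rw [zero_mul, mul_zero] at e3
    have hsq : Tendsto (fun k => eLpNorm (fun s => W k (P.edge i s) - g (P.edge i s)) 2
        (volume.restrict (Icc 0 (P.len i))) ^ 2) atTop (𝓝 0) := by
      simp_rw [eLpNorm_two_pow_two]
      exact tendsto_of_tendsto_of_tendsto_of_le_of_le tendsto_const_nhds e3 (fun _ => zero_le)
        fun k => hbd k i
    exact ENNReal.tendsto_zero_of_sq hsq
  refine ⟨g, fun i => ?_, W, hWs, ?_, hpd 1, hpd Complex.I, hlim⟩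
  · have hd : MemLp (fun s => W 0 (P.edge i s) - g (P.edge i s)) 2
        (volume.restrict (Icc 0 (P.len i))) := by
      refine (memLp_two_iff_lintegral ((hWc 0 i).aestronglyMeasurable.sub (hgm i))).2 ?_
      exact (hbd 0 i).trans_lt (ENNReal.mul_lt_top (by simp)
        (ENNReal.mul_lt_top (by simp) (hfin i)))
    have hw := (hasTrace_of_contDiff (P := P) (hWs 0)).1 i
    refine (hw.sub hd).ae_eq (Eventually.of_forall fun s => ?_)
    simp
  · refine (tendsto_eLpNorm_mul_translate (P := P) hB h0 ha_lim).congr fun k => ?_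
    refine eLpNorm_congr_ae ?_
    filter_upwards [ae_restrict_mem P.isOpen.measurableSet] with z hz
    rw [hWeq k z (subset_closure hz), indicator_of_mem hz]
    by_cases hs : z ∈ tsupport η
    · rw [indicator_of_mem (haK k z hs (subset_closure hz))]; ring
    · rw [hη0 z hs]; ring

end Local

/-- In a curvilinear polygon every smooth function with square integrable gradient has a trace. -/
theorem exists_hasTrace (hu : ContDiffOn ℝ ∞ u P.carrier)
    (h1 : MemLp (pdOne u) 2 (volume.restrict P.carrier))
    (h2 : MemLp (pdTwo u) 2 (volume.restrict P.carrier)) : ∃ g, P.HasTrace u g := by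
  obtain ⟨ι, _, η, hη, hηc, hηs, hη1⟩ := P.exists_partitionOfUnity
  have h0 := memLp_of_memLp_gradient hu h1 h2
  have h : ∀ j, ∃ g, P.HasTrace (fun z => η j z * u z) g := by
    intro j
    rcases hηs j with h | ⟨C, h⟩
    · exact ⟨_, hasTrace_of_contDiff (hu.mul_of_tsupport_subset P.isOpen (hη j) h)⟩
    · exact exists_hasTrace_mul hu h0 h1 h2 (hη j) (hηc j) h
  choose g hg using h
  refine ⟨_, (HasTrace.sum (fun j z hz => ?_) hg).congr fun z hz => ?_⟩
  · exact ((hη j).differentiable (by simp) z).mul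
      ((hu.contDiffAt (P.isOpen.mem_nhds hz)).differentiableAt (by simp))
  · rw [← Finset.sum_mul, hη1 z (subset_closure hz), one_mul]

end CurvilinearPolygon

/-! ### Integration by parts for functions with a trace -/

/-- The pairing of `L²` functions is continuous. -/
theorem tendsto_integral_mul_of_eLpNorm {α : Type*} [MeasurableSpace α] {μ : Measure α}
    {f h : α → ℝ} {F : ℕ → α → ℝ} (hf : MemLp f 2 μ) (hh : MemLp h 2 μ)
    (hF : ∀ k, MemLp (F k) 2 μ)
    (hlim : Tendsto (fun k => eLpNorm (fun x => F k x - f x) 2 μ) atTop (𝓝 0)) :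
    Tendsto (fun k => ∫ x, F k x * h x ∂μ) atTop (𝓝 (∫ x, f x * h x ∂μ)) := by
  have hb := ENNReal.Tendsto.mul_const (b := eLpNorm h 2 μ) hlim (Or.inr hh.2.ne)
  rw [zero_mul] at hb
  refine tendsto_integral_of_L1 _ (hf.integrable_mul hh).aestronglyMeasurable
    (Eventually.of_forall fun k => (hF k).integrable_mul hh) ?_
  refine tendsto_of_tendsto_of_tendsto_of_le_of_le tendsto_const_nhds hb (fun _ => zero_le)
    fun k => ?_
  have h1 := eLpNorm_smul_le_mul_eLpNorm (p := 2) (q := 2) (r := 1) hh.1 ((hF k).1.sub hf.1)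
  rw [eLpNorm_one_eq_lintegral_enorm] at h1
  refine le_trans (le_of_eq (lintegral_congr fun x => ?_)) h1
  congr 1
  simp only [Pi.mul_apply, Pi.sub_apply, smul_eq_mul, Pi.smul_apply']
  ring

theorem two_le_infty : (2 : ℕ∞ω) ≤ ((⊤ : ℕ∞) : ℕ∞ω) :=
  WithTop.coe_le_coe.2 (le_top : (2 : ℕ∞) ≤ ⊤)

theorem InnerProductSpace.HarmonicOnNhd.contDiffOn_infty {u : ℂ → ℝ} {K : Set ℂ}
    (hu : InnerProductSpace.HarmonicOnNhd u K) : ContDiffOn ℝ ∞ u K := fun z hz =>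
  (HarmonicAt.analyticAt (hu z hz)).contDiffAt.contDiffWithinAt

section ComplexDerivative

variable {G : ℂ → ℂ} {g z : ℂ}

theorem HasDerivAt.hasFDerivAt_re (h : HasDerivAt G g z) :
    HasFDerivAt (fun w => (G w).re)
      (Complex.reCLM.comp ((ContinuousLinearMap.toSpanSingleton ℂ g).restrictScalars ℝ)) z :=
  Complex.reCLM.hasFDerivAt.comp z (h.hasFDerivAt.restrictScalars ℝ)

theorem HasDerivAt.hasFDerivAt_im (h : HasDerivAt G g z) :
    HasFDerivAt (fun w => (G w).im)
      (Complex.imCLM.comp ((ContinuousLinearMap.toSpanSingleton ℂ g).restrictScalars ℝ)) z :=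
  Complex.imCLM.hasFDerivAt.comp z (h.hasFDerivAt.restrictScalars ℝ)

theorem pdOne_re (h : HasDerivAt G g z) : pdOne (fun w => (G w).re) z = g.re := by
  rw [pdOne, h.hasFDerivAt_re.fderiv]; simp

theorem pdTwo_re (h : HasDerivAt G g z) : pdTwo (fun w => (G w).re) z = -g.im := by
  rw [pdTwo, h.hasFDerivAt_re.fderiv]; simp

theorem pdOne_im (h : HasDerivAt G g z) : pdOne (fun w => (G w).im) z = g.im := by
  rw [pdOne, h.hasFDerivAt_im.fderiv]; simp

theorem pdTwo_im (h : HasDerivAt G g z) : pdTwo (fun w => (G w).im) z = g.re := by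
  rw [pdTwo, h.hasFDerivAt_im.fderiv]; simp

end ComplexDerivative

namespace CurvilinearPolygon

variable {P : CurvilinearPolygon}

instance : IsFiniteMeasure (volume.restrict P.carrier) :=
  ⟨by rw [Measure.restrict_apply_univ]; exact P.isBounded.measure_lt_top⟩

theorem _root_.Continuous.memLp_carrier {v : ℂ → ℝ} (hv : Continuous v) :
    MemLp v 2 (volume.restrict P.carrier) := by
  obtain ⟨b, hb⟩ := P.isCompact_closure.exists_bound_of_continuousOn (hv.continuousOn)
  exact MemLp.of_bound hv.aestronglyMeasurable b
    ((ae_restrict_mem P.isOpen.measurableSet).mono fun z hz => hb z (subset_closure hz))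

theorem _root_.Continuous.memLp_Icc {v : ℝ → ℝ} (hv : Continuous v) (l : ℝ) :
    MemLp v 2 (volume.restrict (Icc 0 l)) := by
  obtain ⟨b, hb⟩ := isCompact_Icc.exists_bound_of_continuousOn (hv.continuousOn (s := Icc 0 l))
  exact MemLp.of_bound hv.aestronglyMeasurable b ((ae_restrict_mem measurableSet_Icc).mono hb)

variable {u g v : ℂ → ℝ}

theorem contDiff_fderiv_apply (hv : ContDiff ℝ ∞ v) (e : ℂ) :
    ContDiff ℝ ∞ fun z => fderiv ℝ v z e :=
  (hv.fderiv_right (m := ∞) (by simp)).clm_apply contDiff_const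

theorem IsHarmonicH1.memLp_fderiv_apply (hu : P.IsHarmonicH1 u) (e : ℂ) :
    MemLp (fun z => fderiv ℝ u z e) 2 (volume.restrict P.carrier) :=
  _root_.memLp_fderiv_apply hu.2.2.1 hu.2.2.2 e

/-- Integration by parts for a limit of smooth functions. -/
theorem integral_fderiv_mul_of_tendsto {w : ℕ → ℂ → ℝ} {e : ℂ} (hu : P.IsHarmonicH1 u)
    (hg : ∀ i, MemLp (fun s => g (P.edge i s)) 2 (volume.restrict (Icc 0 (P.len i))))
    (hw : ∀ k, ContDiff ℝ ∞ (w k))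
    (h0 : Tendsto (fun k => eLpNorm (fun z => w k z - u z) 2 (volume.restrict P.carrier))
      atTop (𝓝 0))
    (h1 : Tendsto (fun k => eLpNorm (fun z => fderiv ℝ (w k) z e - fderiv ℝ u z e) 2
      (volume.restrict P.carrier)) atTop (𝓝 0))
    (h2 : ∀ i, Tendsto (fun k => eLpNorm (fun s => w k (P.edge i s) - g (P.edge i s)) 2
      (volume.restrict (Icc 0 (P.len i)))) atTop (𝓝 0))
    (hv : ContDiff ℝ ∞ v) :
    ∫ z in P.carrier, (fderiv ℝ u z e * v z + u z * fderiv ℝ v z e) =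
      P.boundaryIntegral fun i s =>
        g (P.edge i s) * ((P.normal i s * star e).re * v (P.edge i s)) := by
  have hvL := hv.continuous.memLp_carrier (P := P)
  have hvL' := (contDiff_fderiv_apply hv e).continuous.memLp_carrier (P := P)
  have hwL := fun k => (hw k).continuous.memLp_carrier (P := P)
  have hwL' := fun k => (contDiff_fderiv_apply (hw k) e).continuous.memLp_carrier (P := P)
  have hb : ∀ i, Continuous fun s => (P.normal i s * star e).re * v (P.edge i s) := fun i =>
    (Complex.continuous_re.comp ((continuous_normal i).mul continuous_const)).mul
      (hv.continuous.comp (continuous_edge i))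
  have l1 := tendsto_integral_mul_of_eLpNorm (hu.memLp_fderiv_apply e) hvL hwL' h1
  have l2 := tendsto_integral_mul_of_eLpNorm hu.2.1 hvL' hwL h0
  have l3 : Tendsto (fun k => P.boundaryIntegral fun i s =>
      w k (P.edge i s) * ((P.normal i s * star e).re * v (P.edge i s))) atTop
      (𝓝 (P.boundaryIntegral fun i s =>
        g (P.edge i s) * ((P.normal i s * star e).re * v (P.edge i s)))) :=
    tendsto_finsetSum _ fun i _ => tendsto_integral_mul_of_eLpNorm (hg i)
      ((hb i).memLp_Icc _)
      (fun k => ((hw k).continuous.comp (continuous_edge i)).memLp_Icc _) (h2 i)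
  have i1 : IntegrableOn (fun z => fderiv ℝ u z e * v z) P.carrier :=
    (hu.memLp_fderiv_apply e).integrable_mul hvL
  have i2 : IntegrableOn (fun z => u z * fderiv ℝ v z e) P.carrier := hu.2.1.integrable_mul hvL'
  have j1 : ∀ k, IntegrableOn (fun z => fderiv ℝ (w k) z e * v z) P.carrier :=
    fun k => (hwL' k).integrable_mul hvL
  have j2 : ∀ k, IntegrableOn (fun z => w k z * fderiv ℝ v z e) P.carrier :=
    fun k => (hwL k).integrable_mul hvL'
  rw [integral_add i1 i2]
  -- For each `k` the identity is the divergence theorem for `w k * v`; all terms are `L²` pairings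
  -- and pass to the limit.
  refine tendsto_nhds_unique (l1.add l2) (l3.congr fun k => ?_)
  rw [← integral_add (j1 k) (j2 k)]
  have h := setIntegral_fderiv P (((hw k).mul hv).of_le (m := 1) (by simp)) e
  refine Eq.trans ?_ (h.symm.trans ?_)
  · exact boundaryIntegral_congr P fun i s _ => by ring
  · refine setIntegral_congr_fun P.isOpen.measurableSet fun z _ => ?_
    have := fderiv_fun_mul ((hw k).differentiable (by simp) z) (hv.differentiable (by simp) z)
    rw [this]
    simp only [_root_.add_apply, _root_.smul_apply, smul_eq_mul]
    ring

/-- Integration by parts in the first variable, for functions that have a trace. -/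
theorem HasTrace.integral_pdOne (h : P.HasTrace u g) (hu : P.IsHarmonicH1 u) (hv : ContDiff ℝ ∞ v) :
    ∫ z in P.carrier, (pdOne u z * v z + u z * pdOne v z) =
      P.boundaryIntegral fun i s => g (P.edge i s) * ((P.normal i s).re * v (P.edge i s)) := by
  obtain ⟨hg, w, hw, h0, h1, -, h3⟩ := h
  simpa [pdOne] using integral_fderiv_mul_of_tendsto (e := 1) hu hg hw h0 h1 h3 hv

/-- Integration by parts in the second variable, for functions that have a trace. -/
theorem HasTrace.integral_pdTwo (h : P.HasTrace u g) (hu : P.IsHarmonicH1 u) (hv : ContDiff ℝ ∞ v) :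
    ∫ z in P.carrier, (pdTwo u z * v z + u z * pdTwo v z) =
      P.boundaryIntegral fun i s => g (P.edge i s) * ((P.normal i s).im * v (P.edge i s)) := by
  obtain ⟨hg, w, hw, h0, -, h2, h3⟩ := h
  simpa [pdTwo] using integral_fderiv_mul_of_tendsto (e := Complex.I) hu hg hw h0 h2 h3 hv

theorem HasTrace.integrableOn_edge (h : P.HasTrace u g) {b : ℝ → ℝ} (hb : Continuous b)
    (i : Fin P.numEdges) : IntegrableOn (fun s => g (P.edge i s) * b s) (Icc 0 (P.len i)) :=
  (h.1 i).integrable_mul (hb.memLp_Icc _)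

theorem boundaryIntegral_add {F G : Fin P.numEdges → ℝ → ℝ}
    (hF : ∀ i, IntegrableOn (F i) (Icc 0 (P.len i)))
    (hG : ∀ i, IntegrableOn (G i) (Icc 0 (P.len i))) :
    P.boundaryIntegral F + P.boundaryIntegral G =
      P.boundaryIntegral fun i s => F i s + G i s := by
  simp only [boundaryIntegral]
  rw [← Finset.sum_add_distrib]
  exact Finset.sum_congr rfl fun i _ => (integral_add (hF i) (hG i)).symm

theorem boundaryIntegral_sub {F G : Fin P.numEdges → ℝ → ℝ}
    (hF : ∀ i, IntegrableOn (F i) (Icc 0 (P.len i)))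
    (hG : ∀ i, IntegrableOn (G i) (Icc 0 (P.len i))) :
    P.boundaryIntegral F - P.boundaryIntegral G =
      P.boundaryIntegral fun i s => F i s - G i s := by
  simp only [boundaryIntegral]
  rw [← Finset.sum_sub_distrib]
  exact Finset.sum_congr rfl fun i _ => (integral_sub (hF i) (hG i)).symm

theorem continuous_normal_re (i : Fin P.numEdges) : Continuous fun s => (P.normal i s).re :=
  Complex.continuous_re.comp (continuous_normal i)

theorem continuous_normal_im (i : Fin P.numEdges) : Continuous fun s => (P.normal i s).im :=
  Complex.continuous_im.comp (continuous_normal i)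

theorem pdOne_pdTwo_comm (hv : ContDiff ℝ ∞ v) (z : ℂ) :
    pdOne (pdTwo v) z = pdTwo (pdOne v) z := by
  have hd : DifferentiableAt ℝ (fderiv ℝ v) z :=
    (hv.fderiv_right (m := ∞) (by simp)).differentiable (by simp) z
  have hs : IsSymmSndFDerivAt ℝ v z := hv.contDiffAt.isSymmSndFDerivAt
    (by simpa using two_le_infty)
  have h : ∀ e e' : ℂ, fderiv ℝ (fun w => fderiv ℝ v w e) z e' = fderiv ℝ (fderiv ℝ v) z e' e := by
    intro e e'
    rw [fderiv_clm_apply hd (by fun_prop)]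
    simp
  simp only [pdOne, pdTwo]
  have h1 := h Complex.I 1
  have h2 := h 1 Complex.I
  exact h1.trans ((hs.eq 1 Complex.I).trans h2.symm)

/-- The tangential derivative of the trace as a boundary value of the rotated gradient. -/
theorem HasTrace.integral_rotated_gradient (h : P.HasTrace u g) (hu : P.IsHarmonicH1 u)
    (hv : ContDiff ℝ ∞ v) :
    ∫ z in P.carrier, (-pdTwo u z * pdOne v z + pdOne u z * pdTwo v z) =
      -P.tangentialDeriv g v := by
  have hv1 : ContDiff ℝ ∞ (pdOne v) := contDiff_fderiv_apply hv 1
  have hv2 : ContDiff ℝ ∞ (pdTwo v) := contDiff_fderiv_apply hv Complex.I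
  have hv12 : ContDiff ℝ ∞ (pdOne (pdTwo v)) := contDiff_fderiv_apply hv2 1
  have hv21 : ContDiff ℝ ∞ (pdTwo (pdOne v)) := contDiff_fderiv_apply hv1 Complex.I
  -- With the derivatives of `v` as test functions, the mixed second derivatives cancel on
  -- subtraction. As `n = -it`, the boundary factor `n₁∂₂v - n₂∂₁v` is `∂v/∂t`.
  have e1 := h.integral_pdOne hu hv2
  have e2 := h.integral_pdTwo hu hv1
  have i1 : IntegrableOn (fun z => pdOne u z * pdTwo v z + u z * pdOne (pdTwo v) z) P.carrier :=
    (hu.2.2.1.integrable_mul hv2.continuous.memLp_carrier).add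
      (hu.2.1.integrable_mul hv12.continuous.memLp_carrier)
  have i2 : IntegrableOn (fun z => pdTwo u z * pdOne v z + u z * pdTwo (pdOne v) z) P.carrier :=
    (hu.2.2.2.integrable_mul hv1.continuous.memLp_carrier).add
      (hu.2.1.integrable_mul hv21.continuous.memLp_carrier)
  have e3 : ∫ z in P.carrier, (-pdTwo u z * pdOne v z + pdOne u z * pdTwo v z) =
      (∫ z in P.carrier, (pdOne u z * pdTwo v z + u z * pdOne (pdTwo v) z)) -
      ∫ z in P.carrier, (pdTwo u z * pdOne v z + u z * pdTwo (pdOne v) z) := by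
    rw [← integral_sub i1 i2]
    refine setIntegral_congr_fun P.isOpen.measurableSet fun z _ => ?_
    rw [pdOne_pdTwo_comm hv]
    ring
  rw [e3, e1, e2, tangentialDeriv, neg_neg, boundaryIntegral_sub]
  · refine boundaryIntegral_congr P fun i s _ => ?_
    rw [fderiv_apply_eq v]
    simp only [normal, neg_mul, Complex.neg_re, Complex.neg_im, Complex.mul_re, Complex.mul_im,
      Complex.I_re, Complex.I_im]
    ring
  · exact fun i => h.integrableOn_edge
      ((continuous_normal_re i).mul (hv2.continuous.comp (continuous_edge i))) i
  · exact fun i => h.integrableOn_edge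
      ((continuous_normal_im i).mul (hv1.continuous.comp (continuous_edge i))) i

/-- The normal component of the traces of a divergence free field. -/
theorem integral_field_eq_normalComponent {a b ga gb : ℂ → ℝ} (hta : P.HasTrace a ga)
    (htb : P.HasTrace b gb) (ha : P.IsHarmonicH1 a) (hb : P.IsHarmonicH1 b)
    (hdiv : ∀ z ∈ P.carrier, pdOne a z + pdTwo b z = 0) (hv : ContDiff ℝ ∞ v) :
    ∫ z in P.carrier, (a z * pdOne v z + b z * pdTwo v z) = P.normalComponent ga gb v := by
  have hv1 : ContDiff ℝ ∞ (pdOne v) := contDiff_fderiv_apply hv 1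
  have hv2 : ContDiff ℝ ∞ (pdTwo v) := contDiff_fderiv_apply hv Complex.I
  have i1 : IntegrableOn (fun z => pdOne a z * v z + a z * pdOne v z) P.carrier :=
    (ha.2.2.1.integrable_mul hv.continuous.memLp_carrier).add
      (ha.2.1.integrable_mul hv1.continuous.memLp_carrier)
  have i2 : IntegrableOn (fun z => pdTwo b z * v z + b z * pdTwo v z) P.carrier :=
    (hb.2.2.2.integrable_mul hv.continuous.memLp_carrier).add
      (hb.2.1.integrable_mul hv2.continuous.memLp_carrier)
  have e3 : ∫ z in P.carrier, (a z * pdOne v z + b z * pdTwo v z) =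
      (∫ z in P.carrier, (pdOne a z * v z + a z * pdOne v z)) +
      ∫ z in P.carrier, (pdTwo b z * v z + b z * pdTwo v z) := by
    rw [← integral_add i1 i2]
    refine setIntegral_congr_fun P.isOpen.measurableSet fun z hz => ?_
    have := hdiv z hz
    linear_combination (-v z) * this
  rw [e3, hta.integral_pdOne ha hv, htb.integral_pdTwo hb hv, boundaryIntegral_add]
  · exact boundaryIntegral_congr P fun i s _ => by ring
  · exact fun i => hta.integrableOn_edge
      ((continuous_normal_re i).mul (hv.continuous.comp (continuous_edge i))) i
  · exact fun i => htb.integrableOn_edge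
      ((continuous_normal_im i).mul (hv.continuous.comp (continuous_edge i))) i

theorem differentiableAt_of_harmonicOnNhd (hu : InnerProductSpace.HarmonicOnNhd u P.carrier) {z : ℂ}
    (hz : z ∈ P.carrier) : DifferentiableAt ℝ u z :=
  (hu.contDiffOn_infty.contDiffAt (P.isOpen.mem_nhds hz)).differentiableAt (by simp)

theorem continuousOn_fderiv_apply (hu : InnerProductSpace.HarmonicOnNhd u P.carrier) (e : ℂ) :
    ContinuousOn (fun z => fderiv ℝ u z e) P.carrier :=
  (hu.contDiffOn_infty.continuousOn_fderiv_of_isOpen P.isOpen (by simp)).clm_apply continuousOn_const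

theorem IsHarmonicH1.sub {u' : ℂ → ℝ} (hu : P.IsHarmonicH1 u) (hu' : P.IsHarmonicH1 u') :
    P.IsHarmonicH1 fun z => u z - u' z := by
  have hfd : ∀ e : ℂ, (fun z => fderiv ℝ u z e - fderiv ℝ u' z e) =ᵐ[volume.restrict P.carrier]
      fun z => fderiv ℝ (fun z => u z - u' z) z e := fun e => by
    filter_upwards [ae_restrict_mem P.isOpen.measurableSet] with z hz
    rw [fderiv_fun_sub (differentiableAt_of_harmonicOnNhd hu.1 hz)
      (differentiableAt_of_harmonicOnNhd hu'.1 hz), _root_.sub_apply]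
  exact ⟨hu.1.sub hu'.1, hu.2.1.sub hu'.2.1, (hu.2.2.1.sub hu'.2.2.1).ae_eq (hfd 1),
    (hu.2.2.2.sub hu'.2.2.2).ae_eq (hfd Complex.I)⟩

theorem IsHarmonicH1.neg (hu : P.IsHarmonicH1 u) : P.IsHarmonicH1 fun z => -u z := by
  have hfd : ∀ e : ℂ, (fun z => fderiv ℝ (fun z => -u z) z e) = fun z => -fderiv ℝ u z e :=
    fun e => by
      ext z
      rw [fderiv_fun_neg, _root_.neg_apply]
  refine ⟨hu.1.neg, hu.2.1.neg, ?_, ?_⟩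
  · have := hu.2.2.1.neg
    exact this.ae_eq (Eventually.of_forall fun z => (congr_fun (hfd 1) z).symm)
  · have := hu.2.2.2.neg
    exact this.ae_eq (Eventually.of_forall fun z => (congr_fun (hfd Complex.I) z).symm)

/-! ### Uniqueness of Neumann solutions -/

/-- A solution of a Neumann problem is unique up to a constant. -/
theorem IsNeumannSolution.gradient_eq {ℓ : (ℂ → ℝ) → ℝ} {u u' : ℂ → ℝ}
    (h : P.IsNeumannSolution ℓ u) (h' : P.IsNeumannSolution ℓ u') :
    ∀ z ∈ P.carrier, pdOne u z = pdOne u' z ∧ pdTwo u z = pdTwo u' z := by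
  have hd := h.1.sub h'.1
  set d : ℂ → ℝ := fun z => u z - u' z with hd_def
  have hfd : ∀ z ∈ P.carrier, ∀ e : ℂ, fderiv ℝ d z e = fderiv ℝ u z e - fderiv ℝ u' z e :=
    fun z hz e => by
      rw [hd_def, fderiv_fun_sub (differentiableAt_of_harmonicOnNhd h.1.1 hz)
        (differentiableAt_of_harmonicOnNhd h'.1.1 hz), _root_.sub_apply]
  have horth : ∀ v : ℂ → ℝ, ContDiff ℝ ∞ v →
      (∫ z in P.carrier, pdOne v z * pdOne d z) + ∫ z in P.carrier, pdTwo v z * pdTwo d z = 0 := by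
    intro v hv
    have hv1 := (contDiff_fderiv_apply hv 1).continuous.memLp_carrier (P := P)
    have hv2 := (contDiff_fderiv_apply hv Complex.I).continuous.memLp_carrier (P := P)
    have e := (h.2 v hv).trans (h'.2 v hv).symm
    have j : ∀ {w : ℂ → ℝ}, P.IsHarmonicH1 w →
        IntegrableOn (fun z => pdOne w z * pdOne v z + pdTwo w z * pdTwo v z) P.carrier :=
      fun hw => (hw.2.2.1.integrable_mul hv1).add (hw.2.2.2.integrable_mul hv2)
    rw [← sub_eq_zero, ← integral_sub (j h.1) (j h'.1)] at e
    have i1 : IntegrableOn (fun z => pdOne v z * pdOne d z) P.carrier :=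
      hv1.integrable_mul hd.2.2.1
    have i2 : IntegrableOn (fun z => pdTwo v z * pdTwo d z) P.carrier :=
      hv2.integrable_mul hd.2.2.2
    rw [← e, ← integral_add i1 i2]
    refine setIntegral_congr_fun P.isOpen.measurableSet fun z hz => ?_
    have e1 : pdOne d z = pdOne u z - pdOne u' z := hfd z hz 1
    have e2 : pdTwo d z = pdTwo u z - pdTwo u' z := hfd z hz Complex.I
    simp only [e1, e2]
    ring
  -- The difference `d` is not an admissible test function, but the smooth approximations that come
  -- with its trace are. Their limit gives `∫ |∇d|² = 0`.
  obtain ⟨g, -, w, hw, -, t1, t2, -⟩ := exists_hasTrace hd.1.contDiffOn_infty hd.2.2.1 hd.2.2.2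
  have l1 := tendsto_integral_mul_of_eLpNorm hd.2.2.1 hd.2.2.1
    (fun k => (contDiff_fderiv_apply (hw k) 1).continuous.memLp_carrier (P := P)) t1
  have l2 := tendsto_integral_mul_of_eLpNorm hd.2.2.2 hd.2.2.2
    (fun k => (contDiff_fderiv_apply (hw k) Complex.I).continuous.memLp_carrier (P := P)) t2
  have l3 := l1.add l2
  have hz0 := tendsto_nhds_unique l3 (tendsto_const_nhds.congr fun k => (horth (w k) (hw k)).symm)
  have hn : ∀ f : ℂ → ℝ, 0 ≤ ∫ z in P.carrier, f z * f z := fun f =>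
    integral_nonneg fun z => mul_self_nonneg (f z)
  have hzero : ∀ e : ℂ, MemLp (fun z => fderiv ℝ d z e) 2 (volume.restrict P.carrier) →
      ∫ z in P.carrier, fderiv ℝ d z e * fderiv ℝ d z e = 0 →
      ∀ z ∈ P.carrier, fderiv ℝ d z e = 0 := by
    intro e hm hi
    rw [integral_eq_zero_iff_of_nonneg (fun z => mul_self_nonneg _) (hm.integrable_mul hm)] at hi
    -- A continuous function that vanishes almost everywhere on an open set vanishes there
    -- identically.
    refine Measure.eqOn_open_of_ae_eq (μ := volume) (hi.mono fun z hz => ?_) P.isOpen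
      (continuousOn_fderiv_apply hd.1 e) (continuousOn_const (c := (0 : ℝ)))
    exact mul_self_eq_zero.1 hz
  have a1 := hn (pdOne d)
  have a2 := hn (pdTwo d)
  have b1 : ∫ z in P.carrier, pdOne d z * pdOne d z = 0 := by linarith
  have b2 : ∫ z in P.carrier, pdTwo d z * pdTwo d z = 0 := by linarith
  have h1 := hzero 1 hd.2.2.1 b1
  have h2 := hzero Complex.I hd.2.2.2 b2
  intro z hz
  refine ⟨sub_eq_zero.1 ?_, sub_eq_zero.1 ?_⟩
  · rw [← h1 z hz]; exact (hfd z hz 1).symm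
  · rw [← h2 z hz]; exact (hfd z hz Complex.I).symm

/-! ### Explicit solutions from holomorphic primitives -/

/-- The real part of a primitive of `a + i b` has gradient `(a, -b)`, and the imaginary part has
gradient `(b, a)`. -/
theorem isHarmonicH1_of_primitive {G : ℂ → ℂ} {a b : ℂ → ℝ}
    (hG : ∀ z ∈ P.carrier, HasDerivAt G ⟨a z, b z⟩ z)
    (ha : MemLp a 2 (volume.restrict P.carrier)) (hb : MemLp b 2 (volume.restrict P.carrier)) :
    P.IsHarmonicH1 (fun z => (G z).re) ∧ P.IsHarmonicH1 (fun z => (G z).im) := by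
  have han : ∀ z ∈ P.carrier, AnalyticAt ℂ G z := fun z hz =>
    DifferentiableOn.analyticAt (s := P.carrier)
      (fun w hw => (hG w hw).differentiableAt.differentiableWithinAt) (P.isOpen.mem_nhds hz)
  have hre : InnerProductSpace.HarmonicOnNhd (fun z => (G z).re) P.carrier := fun z hz =>
    (han z hz).harmonicAt_re
  have him : InnerProductSpace.HarmonicOnNhd (fun z => (G z).im) P.carrier := fun z hz =>
    (han z hz).harmonicAt_im
  have hae : ∀ {f f' : ℂ → ℝ}, MemLp f 2 (volume.restrict P.carrier) →
      (∀ z ∈ P.carrier, f' z = f z) → MemLp f' 2 (volume.restrict P.carrier) := fun hf h =>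
    hf.ae_eq ((ae_restrict_mem P.isOpen.measurableSet).mono fun z hz => (h z hz).symm)
  have r1 := hae ha fun z hz => pdOne_re (hG z hz)
  have r2 := hae hb.neg fun z hz => pdTwo_re (hG z hz)
  have i1 := hae hb fun z hz => pdOne_im (hG z hz)
  have i2 := hae ha fun z hz => pdTwo_im (hG z hz)
  -- Nothing is known about the size of a primitive; its square integrability follows from that of
  -- its gradient.
  exact ⟨⟨hre, memLp_of_memLp_gradient hre.contDiffOn_infty r1 r2, r1, r2⟩,
    ⟨him, memLp_of_memLp_gradient him.contDiffOn_infty i1 i2, i1, i2⟩⟩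

/-- A primitive of `φ₁ - i φ₂`, where `φ₁` and `φ₂` are the derivatives of the harmonic function
`φ`. -/
theorem exists_primitive_gradient {φ : ℂ → ℝ}
    (hφ : InnerProductSpace.HarmonicOnNhd φ P.carrier) :
    ∃ H : ℂ → ℂ, ∀ z ∈ P.carrier, HasDerivAt H ⟨pdOne φ z, -pdTwo φ z⟩ z := by
  refine isExactOn_of_isSimplyConnected P.isOpen P.isSimplyConnected
    (f := fun z => ⟨pdOne φ z, -pdTwo φ z⟩) fun z hz => ?_
  have h := HarmonicAt.differentiableAt_complex_partial (hφ z hz)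
  refine (h.congr_of_eventuallyEq (Eventually.of_forall fun w => ?_)).differentiableWithinAt
  apply Complex.ext <;> simp [pdOne, pdTwo]

/-- The Neumann problem with the tangential derivative of a trace as boundary data has a solution,
the harmonic conjugate. -/
theorem exists_isNeumannSolution_tangentialDeriv {φ g : ℂ → ℝ} (hφ : P.IsHarmonicH1 φ)
    (hg : P.HasTrace φ g) :
    ∃ ψ, P.IsNeumannSolution (fun v => -P.tangentialDeriv g v) ψ ∧
      ∀ z ∈ P.carrier, pdOne ψ z = -pdTwo φ z ∧ pdTwo ψ z = pdOne φ z := by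
  obtain ⟨H, hH⟩ := exists_primitive_gradient hφ.1
  have hpd : ∀ z ∈ P.carrier, pdOne (fun z => (H z).im) z = -pdTwo φ z ∧
      pdTwo (fun z => (H z).im) z = pdOne φ z := fun z hz => ⟨pdOne_im (hH z hz), pdTwo_im (hH z hz)⟩
  refine ⟨_, ⟨(isHarmonicH1_of_primitive hH hφ.2.2.1 hφ.2.2.2.neg).2, fun v hv => ?_⟩, hpd⟩
  beta_reduce
  rw [← hg.integral_rotated_gradient hφ hv]
  refine setIntegral_congr_fun P.isOpen.measurableSet fun z hz => ?_
  simp only [(hpd z hz).1, (hpd z hz).2]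

/-- The trace `g` in the hypothesis is some witness, so the conjugate is taken as the solution for
this same `g`; uniqueness then transfers its gradient. -/
theorem SolvesTangentialNeumann.gradient_eq {φ ψ : ℂ → ℝ} (h : P.SolvesTangentialNeumann φ ψ)
    (hφ : P.IsHarmonicH1 φ) :
    ∀ z ∈ P.carrier, pdOne ψ z = -pdTwo φ z ∧ pdTwo ψ z = pdOne φ z := by
  obtain ⟨g, hg, hs⟩ := h
  obtain ⟨ψ₀, hs₀, hpd⟩ := exists_isNeumannSolution_tangentialDeriv hφ hg
  intro z hz
  rw [(hs.gradient_eq hs₀ z hz).1, (hs.gradient_eq hs₀ z hz).2]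
  exact hpd z hz

/-- A harmonic function with gradient `(a, b)` solves the Neumann problem with the normal component
of the traces of `a` and `b` as boundary data. -/
theorem isNeumannSolution_normalComponent {a b ga gb ρ : ℂ → ℝ} (hta : P.HasTrace a ga)
    (htb : P.HasTrace b gb) (ha : P.IsHarmonicH1 a) (hb : P.IsHarmonicH1 b)
    (hdiv : ∀ z ∈ P.carrier, pdOne a z + pdTwo b z = 0) (hρ : P.IsHarmonicH1 ρ)
    (hgrad : ∀ z ∈ P.carrier, pdOne ρ z = a z ∧ pdTwo ρ z = b z) :
    P.IsNeumannSolution (P.normalComponent ga gb) ρ := by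
  refine ⟨hρ, fun v hv => ?_⟩
  rw [← integral_field_eq_normalComponent hta htb ha hb hdiv hv]
  refine setIntegral_congr_fun P.isOpen.measurableSet fun z hz => ?_
  simp only [(hgrad z hz).1, (hgrad z hz).2]

theorem IsHarmonicH1.exists_hasTrace (hu : P.IsHarmonicH1 u) : ∃ g, P.HasTrace u g :=
  CurvilinearPolygon.exists_hasTrace hu.1.contDiffOn_infty hu.2.2.1 hu.2.2.2

theorem exists_solvesNormalNeumann {a b ρ : ℂ → ℝ} (ha : P.IsHarmonicH1 a) (hb : P.IsHarmonicH1 b)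
    (hdiv : ∀ z ∈ P.carrier, pdOne a z + pdTwo b z = 0) (hρ : P.IsHarmonicH1 ρ)
    (hgrad : ∀ z ∈ P.carrier, pdOne ρ z = a z ∧ pdTwo ρ z = b z) :
    P.SolvesNormalNeumann a b ρ := by
  obtain ⟨ga, hga⟩ := ha.exists_hasTrace
  obtain ⟨gb, hgb⟩ := hb.exists_hasTrace
  exact ⟨ga, gb, hga, hgb, isNeumannSolution_normalComponent hga hgb ha hb hdiv hρ hgrad⟩

/-- The reference function `ρ₀` solves the problem for whichever traces `ga`, `gb` the given
solution uses, so uniqueness applies. -/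
theorem SolvesNormalNeumann.gradient_eq {a b ρ ρ₀ : ℂ → ℝ} (h : P.SolvesNormalNeumann a b ρ)
    (ha : P.IsHarmonicH1 a) (hb : P.IsHarmonicH1 b)
    (hdiv : ∀ z ∈ P.carrier, pdOne a z + pdTwo b z = 0) (hρ₀ : P.IsHarmonicH1 ρ₀)
    (hgrad : ∀ z ∈ P.carrier, pdOne ρ₀ z = a z ∧ pdTwo ρ₀ z = b z) :
    ∀ z ∈ P.carrier, pdOne ρ z = a z ∧ pdTwo ρ z = b z := by
  obtain ⟨ga, gb, hga, hgb, hs⟩ := h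
  have hs₀ := isNeumannSolution_normalComponent hga hgb ha hb hdiv hρ₀ hgrad
  intro z hz
  rw [(hs.gradient_eq hs₀ z hz).1, (hs.gradient_eq hs₀ z hz).2]
  exact hgrad z hz

/-- A primitive of the holomorphic function `φ + i ψ`. -/
theorem exists_primitive {φ ψ : ℂ → ℝ} (hφ : InnerProductSpace.HarmonicOnNhd φ P.carrier)
    (hψ : InnerProductSpace.HarmonicOnNhd ψ P.carrier)
    (h : ∀ z ∈ P.carrier, pdOne ψ z = -pdTwo φ z ∧ pdTwo ψ z = pdOne φ z) :
    ∃ G : ℂ → ℂ, ∀ z ∈ P.carrier, HasDerivAt G ⟨φ z, ψ z⟩ z := by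
  refine isExactOn_of_isSimplyConnected P.isOpen P.isSimplyConnected
    (f := fun z => ⟨φ z, ψ z⟩) fun z hz => ?_
  refine DifferentiableAt.differentiableWithinAt ?_
  have h1 := (differentiableAt_of_harmonicOnNhd hφ hz).hasFDerivAt
  have h2 := (differentiableAt_of_harmonicOnNhd hψ hz).hasFDerivAt
  have h3 : HasFDerivAt (fun z => (⟨φ z, ψ z⟩ : ℂ))
      (Complex.equivRealProdCLM.symm.toContinuousLinearMap.comp
        ((fderiv ℝ φ z).prod (fderiv ℝ ψ z))) z :=
    Complex.equivRealProdCLM.symm.toContinuousLinearMap.hasFDerivAt.comp z (h1.prodMk h2)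
  refine differentiableAt_complex_iff_differentiableAt_real.2 ⟨h3.differentiableAt, ?_⟩
  have e1 : fderiv ℝ ψ z 1 = -fderiv ℝ φ z Complex.I := (h z hz).1
  have e2 : fderiv ℝ ψ z Complex.I = fderiv ℝ φ z 1 := (h z hz).2
  rw [h3.fderiv]
  apply Complex.ext <;> simp [e1, e2]

end CurvilinearPolygon

/-! ### The Laplacian of the constructed potentials -/

theorem laplacian_eq_pd {U : ℂ → ℝ} {z : ℂ} (hU : ContDiffAt ℝ 2 U z) :
    Laplacian.laplacian U z = pdOne (pdOne U) z + pdTwo (pdTwo U) z := by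
  have hd : DifferentiableAt ℝ (fderiv ℝ U) z :=
    (hU.fderiv_right (m := 1) (by norm_num)).differentiableAt one_ne_zero
  have h : ∀ e : ℂ, fderiv ℝ (fun w => fderiv ℝ U w e) z e = fderiv ℝ (fderiv ℝ U) z e e := by
    intro e
    rw [fderiv_clm_apply hd (by fun_prop)]
    simp
  rw [InnerProductSpace.laplacian_eq_iteratedFDeriv_complexPlane]
  simp only [iteratedFDeriv_two_apply]
  simp [pdOne, pdTwo, ← h]
  rfl

/-- If `σ` and `τ` have gradients `(α, -β)` and `(β, α)`, then `(x₁ σ + x₂ τ) / 4` has Laplacian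
`α`. -/
theorem hasLaplacianOn_of_gradient {K : Set ℂ} (hK : IsOpen K) {σ τ α β : ℂ → ℝ}
    (hσ : ContDiffOn ℝ ∞ σ K) (hτ : ContDiffOn ℝ ∞ τ K) (hα : ContDiffOn ℝ ∞ α K)
    (hβ : ContDiffOn ℝ ∞ β K) (hgσ : ∀ z ∈ K, pdOne σ z = α z ∧ pdTwo σ z = -β z)
    (hgτ : ∀ z ∈ K, pdOne τ z = β z ∧ pdTwo τ z = α z)
    (hCR : ∀ z ∈ K, pdOne β z = -pdTwo α z ∧ pdTwo β z = pdOne α z) :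
    HasLaplacianOn (fun z => (z.re * σ z + z.im * τ z) / 4) α K := by
  have hre : ContDiff ℝ ∞ fun z : ℂ => z.re := Complex.reCLM.contDiff
  have him : ContDiff ℝ ∞ fun z : ℂ => z.im := Complex.imCLM.contDiff
  have hU : ContDiffOn ℝ ∞ (fun z : ℂ => (z.re * σ z + z.im * τ z) / 4) K :=
    ((hre.contDiffOn.mul hσ).add (him.contDiffOn.mul hτ)).div_const 4
  refine ⟨hU.of_le two_le_infty, fun z hz => ?_⟩
  have hda : ∀ {f : ℂ → ℝ}, ContDiffOn ℝ ∞ f K → ∀ w ∈ K, HasFDerivAt f (fderiv ℝ f w) w :=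
    fun hf w hw => ((hf.contDiffAt (hK.mem_nhds hw)).differentiableAt (by simp)).hasFDerivAt
  have hr : ∀ w : ℂ, HasFDerivAt (fun z : ℂ => z.re) Complex.reCLM w := fun w =>
    Complex.reCLM.hasFDerivAt
  have hi : ∀ w : ℂ, HasFDerivAt (fun z : ℂ => z.im) Complex.imCLM w := fun w =>
    Complex.imCLM.hasFDerivAt
  have hfd : ∀ w ∈ K, ∀ e : ℂ, fderiv ℝ (fun z : ℂ => (z.re * σ z + z.im * τ z) / 4) w e =
      (w.re * fderiv ℝ σ w e + σ w * e.re + (w.im * fderiv ℝ τ w e + τ w * e.im)) / 4 := by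
    intro w hw e
    have := ((((hr w).fun_mul (hda hσ w hw)).fun_add ((hi w).fun_mul (hda hτ w hw))).mul_const
      ((4 : ℝ)⁻¹))
    simp only [← div_eq_mul_inv] at this
    rw [this.fderiv]
    simp
    ring
  have h1 : pdOne (fun z : ℂ => (z.re * σ z + z.im * τ z) / 4) =ᶠ[𝓝 z]
      fun w => (w.re * α w + w.im * β w + σ w) * (4 : ℝ)⁻¹ := by
    filter_upwards [hK.mem_nhds hz] with w hw
    have e1 : fderiv ℝ σ w 1 = α w := (hgσ w hw).1
    have e2 : fderiv ℝ τ w 1 = β w := (hgτ w hw).1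
    rw [pdOne, hfd w hw, e1, e2]
    simp
    ring
  have h2 : pdTwo (fun z : ℂ => (z.re * σ z + z.im * τ z) / 4) =ᶠ[𝓝 z]
      fun w => (w.im * α w - w.re * β w + τ w) * (4 : ℝ)⁻¹ := by
    filter_upwards [hK.mem_nhds hz] with w hw
    have e1 : fderiv ℝ σ w Complex.I = -β w := (hgσ w hw).2
    have e2 : fderiv ℝ τ w Complex.I = α w := (hgτ w hw).2
    rw [pdTwo, hfd w hw, e1, e2]
    simp
    ring
  rw [laplacian_eq_pd ((hU.of_le two_le_infty).contDiffAt (hK.mem_nhds hz)), pdOne, pdTwo,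
    h1.fderiv_eq, h2.fderiv_eq]
  -- The two second derivatives sum to `(4α + x₁(∂₁α - ∂₂β) + x₂(∂₁β + ∂₂α))/4`; the Cauchy–Riemann
  -- equations leave `α`.
  have d1 := (((hr z).fun_mul (hda hα z hz)).fun_add ((hi z).fun_mul (hda hβ z hz))).fun_add
    (hda hσ z hz) |>.mul_const ((4 : ℝ)⁻¹)
  have d2 := (((hi z).fun_mul (hda hα z hz)).fun_sub ((hr z).fun_mul (hda hβ z hz))).fun_add
    (hda hτ z hz) |>.mul_const ((4 : ℝ)⁻¹)
  rw [d1.fderiv, d2.fderiv]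
  have e1 : fderiv ℝ σ z 1 = α z := (hgσ z hz).1
  have e2 : fderiv ℝ τ z Complex.I = α z := (hgτ z hz).2
  have e3 : fderiv ℝ β z 1 = -fderiv ℝ α z Complex.I := (hCR z hz).1
  have e4 : fderiv ℝ β z Complex.I = fderiv ℝ α z 1 := (hCR z hz).2
  simp [e1, e2, e3, e4]
  ring

theorem proposition2 (P : CurvilinearPolygon) (φ : ℂ → ℝ) (hφ : P.IsHarmonicH1 φ) :
    -- each of the three Neumann problems has a solution
    (∃ φh, P.SolvesTangentialNeumann φ φh) ∧
    (∀ φh, P.SolvesTangentialNeumann φ φh →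
      (∃ ρ, P.SolvesNormalNeumann φ (fun z => -φh z) ρ) ∧
      (∃ ρh, P.SolvesNormalNeumann φh φ ρh)) ∧
    -- whatever solutions are chosen, the construction has the stated properties
    (∀ φh ρ ρh, P.SolvesTangentialNeumann φ φh →
      P.SolvesNormalNeumann φ (fun z => -φh z) ρ →
      P.SolvesNormalNeumann φh φ ρh →
      HasLaplacianOn (fun z => (z.re * ρ z + z.im * ρh z) / 4) φ P.carrier ∧
      HasLaplacianOn (fun z => (z.re * ρh z - z.im * ρ z) / 4) φh P.carrier ∧
      P.IsHarmonicConjugate φ φh ∧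
      P.IsHarmonicConjugate ρ ρh) := by
  have hneg : ∀ (u : ℂ → ℝ) (z e : ℂ), fderiv ℝ (fun z => -u z) z e = -fderiv ℝ u z e :=
    fun u z e => by rw [fderiv_fun_neg, _root_.neg_apply]
  -- For any chosen `φ̂`, the real and imaginary parts of a primitive of `φ + iφ̂` are the reference
  -- solutions for steps 2 and 3. They give existence, and by uniqueness the gradients of all other
  -- solutions.
  have key : ∀ φh, P.SolvesTangentialNeumann φ φh → P.IsHarmonicH1 φh ∧
      (∀ z ∈ P.carrier, pdOne φh z = -pdTwo φ z ∧ pdTwo φh z = pdOne φ z) ∧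
      (∀ z ∈ P.carrier, pdOne φ z + pdTwo (fun z => -φh z) z = 0) ∧
      (∀ z ∈ P.carrier, pdOne φh z + pdTwo φ z = 0) ∧
      ∃ ρ₀ ρh₀, P.IsHarmonicH1 ρ₀ ∧ P.IsHarmonicH1 ρh₀ ∧
        (∀ z ∈ P.carrier, pdOne ρ₀ z = φ z ∧ pdTwo ρ₀ z = -φh z) ∧
        (∀ z ∈ P.carrier, pdOne ρh₀ z = φh z ∧ pdTwo ρh₀ z = φ z) := by
    intro φh hs
    have hgrad := hs.gradient_eq hφ
    have hH : P.IsHarmonicH1 φh := by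
      obtain ⟨g, -, h⟩ := hs
      exact h.1
    obtain ⟨G, hG⟩ := CurvilinearPolygon.exists_primitive hφ.1 hH.1 hgrad
    have hGH := CurvilinearPolygon.isHarmonicH1_of_primitive hG hφ.2.1 hH.2.1
    refine ⟨hH, hgrad, fun z hz => ?_, fun z hz => ?_, _, _, hGH.1, hGH.2, fun z hz => ?_,
      fun z hz => ?_⟩
    · have := (hgrad z hz).2
      rw [pdTwo] at this
      rw [pdTwo, hneg, this, add_neg_cancel]
    · rw [(hgrad z hz).1, neg_add_cancel]
    · exact ⟨pdOne_re (hG z hz), pdTwo_re (hG z hz)⟩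
    · exact ⟨pdOne_im (hG z hz), pdTwo_im (hG z hz)⟩
  refine ⟨?_, fun φh hs => ?_, fun φh ρ ρh hs hsρ hsρh => ?_⟩
  · obtain ⟨g, hg⟩ := hφ.exists_hasTrace
    obtain ⟨ψ, hψ, -⟩ := CurvilinearPolygon.exists_isNeumannSolution_tangentialDeriv hφ hg
    exact ⟨ψ, g, hg, hψ⟩
  · obtain ⟨hH, -, hd1, hd2, ρ₀, ρh₀, h1, h2, hg1, hg2⟩ := key φh hs
    exact ⟨⟨ρ₀, CurvilinearPolygon.exists_solvesNormalNeumann hφ hH.neg hd1 h1 hg1⟩,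
      ⟨ρh₀, CurvilinearPolygon.exists_solvesNormalNeumann hH hφ hd2 h2 hg2⟩⟩
  · obtain ⟨hH, hgrad, hd1, hd2, ρ₀, ρh₀, h1, h2, hg1, hg2⟩ := key φh hs
    have gρ := hsρ.gradient_eq hφ hH.neg hd1 h1 hg1
    have gρh := hsρh.gradient_eq hH hφ hd2 h2 hg2
    have hρ : P.IsHarmonicH1 ρ := by
      obtain ⟨_, _, -, -, h⟩ := hsρ
      exact h.1
    have hρh : P.IsHarmonicH1 ρh := by
      obtain ⟨_, _, -, -, h⟩ := hsρh
      exact h.1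
    have sφ := hφ.1.contDiffOn_infty
    have sφh := hH.1.contDiffOn_infty
    have sρ := hρ.1.contDiffOn_infty
    have sρh := hρh.1.contDiffOn_infty
    refine ⟨hasLaplacianOn_of_gradient P.isOpen sρ sρh sφ sφh gρ gρh hgrad, ?_,
      ⟨hφ.1, hH.1, fun z hz => ⟨(hgrad z hz).2.symm, ?_⟩⟩,
      ⟨hρ.1, hρh.1, fun z hz => ⟨?_, ?_⟩⟩⟩
    -- Multiplication of `φ + iφ̂` and `ρ + iρ̂` by `-i` gives `φ̂ - iφ` and `ρ̂ - iρ`, which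
    -- satisfy the same relations, so the second potential is the first one for these pairs.
    · have := hasLaplacianOn_of_gradient (σ := ρh) (τ := fun z => -ρ z) (α := φh)
        (β := fun z => -φ z) P.isOpen sρh sρ.neg sφh sφ.neg
        (fun z hz => ⟨(gρh z hz).1, by rw [(gρh z hz).2, neg_neg]⟩)
        (fun z hz => ⟨?_, ?_⟩) (fun z hz => ⟨?_, ?_⟩)
      · simpa only [mul_neg, ← sub_eq_add_neg] using this
      · rw [pdOne, hneg, ← pdOne, (gρ z hz).1]
      · rw [pdTwo, hneg, ← pdTwo, (gρ z hz).2, neg_neg]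
      · rw [pdOne, hneg, ← pdOne, (hgrad z hz).2]
      · rw [pdTwo, hneg, ← pdTwo, (hgrad z hz).1]
    · rw [(hgrad z hz).1, neg_neg]
    · rw [(gρ z hz).1, (gρh z hz).2]
    · rw [(gρ z hz).2, (gρh z hz).1]
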